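/- Let $m\ge 1$, $K\ge 0$, $T>0$, $L_1,\dots,L_K\in\mathbb C^{m\times m}$, let $H:[0,T]\to\mathbb C^{m\times m}$ be Hermitian-valued and twice continuously differentiable, and let $\gamma_1,\dots,\gamma_K:[0,T]\to[0,\infty)$ be twice continuously differentiable. Let $Q\in\mathbb C^{m\times m}$ be Hermitian, positive semidefinite, with unit trace, and let $q$ be the solution on $[0,T]$ of the adjoint Lindblad equation $$\dot q(t)=-i[H(t),q(t)]-\sum_{k=1}^K\gamma_k(t)\Big(L_k^\dagger q(t)L_k-\tfrac12\{L_k^\dagger L_k,q(t)\}\Big),\qquad q(T)=Q.$$ Put $A(t)=-iH(t)-\frac12\sum_{k}\gamma_k(t)L_k^\dagger L_k$ and let $\|M\|_1=\operatorname{Tr}\sqrt{M^\dagger M}$ be the trace norm. For $N\ge1$ let $\tau=T/N$, $t_n=n\tau$, $t_{n+1/2}=t_n+\tau/2$, and for a matrix $p$ define $$p_{1/2}=e^{\frac\tau2A(t_{n+1})^\dagger}\Big(p+\tfrac\tau2\sum_k\gamma_k(t_{n+1})L_k^\dagger p\,L_k\Big)e^{\frac\tau2A(t_{n+1})},$$ $$\Psi(t_{n+1},p)=e^{\tau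 A(t_{n+1/2})^\dagger}p\,e^{\tau A(t_{n+1/2})}+\tau\sum_k\gamma_k(t_{n+1/2})\,e^{\frac\tau2A(t_{n+1/2})^\dagger}L_k^\dagger p_{1/2}L_k\,e^{\frac\tau2A(t_{n+1/2})}.$$ The unnormalized backward full-rank exponential midpoint scheme is $q_N=Q$, $q_n=\Psi(t_{n+1},q_{n+1})$ for $n=N-1,\dots,0$. Let $C_2=\sum_{k}\big(\max_{0\le t\le T}\gamma_k(t)\big)\|L_k\|_1^2$. Then there is a constant $\tilde C_1>0$, independent of $N$ (hence of $\tau$) and of $n$, such that the truncation errors $\tilde R_n=q(t_n)-\Psi(t_{n+1},q(t_{n+1}))$ satisfy $$\max_{0\le n\le N-1}\|\tilde R_n\|_1\le\tilde C_1\tau^3\qquad\text{for every }N\ge1;$$ and for every such $\tilde C_1$, the constant $\tilde C_3=(e^{C_2T}-1)\tilde C_1/C_2$ (to be read as its limit $T\tilde C_1$ if $C_2=0$) is positive and, for every $N\ge1$, $$\|q(t_n)-q_n\|_1\le\tilde C_3\,\tau^2,\qquad 0\le n\le N.$$ -/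

import Mathlib

open scoped Matrix ComplexOrder

noncomputable section

namespace Lindblad

/-- The trace norm `‖M‖₁ = Tr √(Mᴴ M) = ∑ⱼ σⱼ(M)`: the sum of the singular values of `M`, i.e. of
the square roots of the eigenvalues (with multiplicity) of `Mᴴ M`. -/
def traceNorm {m : ℕ} (M : Matrix (Fin m) (Fin m) ℂ) : ℝ :=
  ∑ j : Fin m, Real.sqrt ((Matrix.isHermitian_conjTranspose_mul_self M).eigenvalues j)

/-- The right-hand side
`-i [H(t), q] - ∑ₖ γₖ(t) (Lₖᴴ q Lₖ - ½ {Lₖᴴ Lₖ, q})` of the adjoint Lindblad equation. -/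
def adjointRHS {m K : ℕ} (H : ℝ → Matrix (Fin m) (Fin m) ℂ)
    (L : Fin K → Matrix (Fin m) (Fin m) ℂ) (γ : Fin K → ℝ → ℝ)
    (t : ℝ) (q : Matrix (Fin m) (Fin m) ℂ) : Matrix (Fin m) (Fin m) ℂ :=
  -(Complex.I • (H t * q - q * H t))
    - ∑ k, γ k t • ((L k)ᴴ * q * L k
        - (1 / 2 : ℝ) • ((L k)ᴴ * L k * q + q * ((L k)ᴴ * L k)))

/-- `q` solves the adjoint Lindblad equation on `[0, T]` with terminal value `q(T) = Q`
(one-sided derivatives at the two end points). -/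
def IsAdjointSolution {m K : ℕ} (T : ℝ) (H : ℝ → Matrix (Fin m) (Fin m) ℂ)
    (L : Fin K → Matrix (Fin m) (Fin m) ℂ) (γ : Fin K → ℝ → ℝ)
    (Q : Matrix (Fin m) (Fin m) ℂ) (q : ℝ → Matrix (Fin m) (Fin m) ℂ) : Prop :=
  (∀ t ∈ Set.Icc (0 : ℝ) T,
    HasDerivWithinAt q (adjointRHS H L γ t (q t)) (Set.Icc (0 : ℝ) T) t) ∧ q T = Q

/-- `A(t) = -i H(t) - ½ ∑ₖ γₖ(t) Lₖᴴ Lₖ`. -/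
def opA {m K : ℕ} (H : ℝ → Matrix (Fin m) (Fin m) ℂ)
    (L : Fin K → Matrix (Fin m) (Fin m) ℂ) (γ : Fin K → ℝ → ℝ)
    (t : ℝ) : Matrix (Fin m) (Fin m) ℂ :=
  -(Complex.I • H t) - (1 / 2 : ℝ) • ∑ k, γ k t • ((L k)ᴴ * L k)

/-- The half-step value of the backward scheme, started from `p` at time `t` (`t = t_{n+1}`) with
step `τ`:
`e^{(τ/2) A(t)ᴴ} (p + (τ/2) ∑ₖ γₖ(t) Lₖᴴ p Lₖ) e^{(τ/2) A(t)}`. -/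
def halfStep {m K : ℕ} (H : ℝ → Matrix (Fin m) (Fin m) ℂ)
    (L : Fin K → Matrix (Fin m) (Fin m) ℂ) (γ : Fin K → ℝ → ℝ)
    (τ t : ℝ) (p : Matrix (Fin m) (Fin m) ℂ) : Matrix (Fin m) (Fin m) ℂ :=
  NormedSpace.exp ((τ / 2) • (opA H L γ t)ᴴ)
    * (p + (τ / 2) • ∑ k, γ k t • ((L k)ᴴ * p * L k))
    * NormedSpace.exp ((τ / 2) • opA H L γ t)

/-- One full step `Ψ(t, p)` (from time `t = t_{n+1}` back to `t - τ = t_n`) of the unnormalized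
full-rank exponential midpoint scheme for the backward equation. With `s = t - τ/2 = t_{n+1/2}`,
`Ψ(t, p) = e^{τ A(s)ᴴ} p e^{τ A(s)}
  + τ ∑ₖ γₖ(s) e^{(τ/2) A(s)ᴴ} Lₖᴴ p_{1/2} Lₖ e^{(τ/2) A(s)}`,
where `p_{1/2}` is the half-step value. -/
def backwardStep {m K : ℕ} (H : ℝ → Matrix (Fin m) (Fin m) ℂ)
    (L : Fin K → Matrix (Fin m) (Fin m) ℂ) (γ : Fin K → ℝ → ℝ)
    (τ t : ℝ) (p : Matrix (Fin m) (Fin m) ℂ) : Matrix (Fin m) (Fin m) ℂ :=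
  NormedSpace.exp (τ • (opA H L γ (t - τ / 2))ᴴ) * p
      * NormedSpace.exp (τ • opA H L γ (t - τ / 2))
    + τ • ∑ k, γ k (t - τ / 2) •
        (NormedSpace.exp ((τ / 2) • (opA H L γ (t - τ / 2))ᴴ)
          * ((L k)ᴴ * halfStep H L γ τ t p * L k)
          * NormedSpace.exp ((τ / 2) • opA H L γ (t - τ / 2)))

/-- `x 0, …, x N` are the values `q₀, …, q_N` of the unnormalized backward scheme on the uniform
grid `t_n = n τ`, `τ = T / N`: `q_N = Q` and `q_n = Ψ(t_{n+1}, q_{n+1})` for `n = N-1, …, 0`.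
(Entries of `x` beyond `N` are irrelevant.) -/
def IsBackwardFREM {m K : ℕ} (T : ℝ) (H : ℝ → Matrix (Fin m) (Fin m) ℂ)
    (L : Fin K → Matrix (Fin m) (Fin m) ℂ) (γ : Fin K → ℝ → ℝ)
    (Q : Matrix (Fin m) (Fin m) ℂ) (N : ℕ) (x : ℕ → Matrix (Fin m) (Fin m) ℂ) : Prop :=
  x N = Q ∧ ∀ n < N,
    x n = backwardStep H L γ (T / N) (((n + 1 : ℕ) : ℝ) * (T / N)) (x (n + 1))

/-- The truncation error `R̃_n = q(t_n) - Ψ(t_{n+1}, q(t_{n+1}))` on the grid with `N` steps. -/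
def truncError {m K : ℕ} (T : ℝ) (H : ℝ → Matrix (Fin m) (Fin m) ℂ)
    (L : Fin K → Matrix (Fin m) (Fin m) ℂ) (γ : Fin K → ℝ → ℝ)
    (q : ℝ → Matrix (Fin m) (Fin m) ℂ) (N n : ℕ) : Matrix (Fin m) (Fin m) ℂ :=
  q ((n : ℝ) * (T / N))
    - backwardStep H L γ (T / N) (((n + 1 : ℕ) : ℝ) * (T / N)) (q (((n + 1 : ℕ) : ℝ) * (T / N)))

/-- `C₁ > 0` is a consistency constant: `max_{0 ≤ n ≤ N-1} ‖R̃_n‖₁ ≤ C₁ τ³`, simultaneously for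
every number `N ≥ 1` of steps, with `τ = T / N`. -/
def IsConsistencyConst {m K : ℕ} (T : ℝ) (H : ℝ → Matrix (Fin m) (Fin m) ℂ)
    (L : Fin K → Matrix (Fin m) (Fin m) ℂ) (γ : Fin K → ℝ → ℝ)
    (q : ℝ → Matrix (Fin m) (Fin m) ℂ) (C₁ : ℝ) : Prop :=
  0 < C₁ ∧ ∀ N : ℕ, 1 ≤ N → ∀ n < N,
    traceNorm (truncError T H L γ q N n) ≤ C₁ * (T / N) ^ 3

/-- `C₂ = ∑ₖ (max_{0 ≤ t ≤ T} γₖ(t)) ‖Lₖ‖₁²`. -/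
def constC₂ {m K : ℕ} (T : ℝ) (L : Fin K → Matrix (Fin m) (Fin m) ℂ)
    (γ : Fin K → ℝ → ℝ) : ℝ :=
  ∑ k, sSup (γ k '' Set.Icc (0 : ℝ) T) * traceNorm (L k) ^ 2

/-- `C₃ = (e^{C₂ T} - 1) C₁ / C₂`, read as its limit `T C₁` in the degenerate case `C₂ = 0`. -/
def constC₃ (T C₁ C₂ : ℝ) : ℝ :=
  if C₂ = 0 then T * C₁ else (Real.exp (C₂ * T) - 1) * C₁ / C₂

end Lindblad

end

open scoped Matrix.Norms.L2Operator

namespace Lindblad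

/-! ### Trace norm through duality with the operator norm -/

section TraceNorm

variable {m : ℕ}

/-! Consistency plus stability give convergence. `Ψ` is linear in `p`, so the error obeys `e_n =
R̃_n + Ψ(e_{n+1})` with `e_N = 0`.

Stability (`traceNorm_backwardStep_le`): `A + Aᴴ = -∑ γₖ Lₖᴴ Lₖ ≤ 0`, so `e^{σA}` is a contraction
and conjugation by it does not increase the trace norm. The jump terms cost at most `C₂`, so one
step amplifies by at most `1 + C₂τ + (C₂τ)²/2 ≤ e^{C₂τ}`. Summing the geometric series gives `C₃`.

Consistency (`isBigO_exact_sub_backwardStep`): on superoperators put `a p = Aᴴ p + p A`, `b p = ∑ γₖ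
Lₖᴴ p Lₖ` and `ℓ = a + b`; the equation is `q' = -ℓ q`. With `s` the midpoint of the step, both the
exact backward flow (`isBigO_exact_sub_midpoint`) and the scheme (`isBigO_midpoint_expansion`) equal
`1 + τ ℓ(s) + (τ²/2) ℓ(s)²` up to `O(τ³)`, uniformly over all admissible steps.

Estimates on the trace norm rest on `‖M‖₁ = max |Tr(U M)|` over `‖U‖ ≤ 1`. -/

lemma norm_mulVec_apply_le (X : Matrix (Fin m) (Fin m) ℂ) (v : Fin m → ℂ) (i : Fin m) :
    ‖(X *ᵥ v) i‖ ≤ ‖X‖ * ‖WithLp.toLp 2 v‖ :=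
  (PiLp.norm_apply_le (WithLp.toLp 2 (X *ᵥ v)) i).trans
    (Matrix.l2_opNorm_mulVec X (WithLp.toLp 2 v))

lemma norm_apply_le_l2_opNorm (X : Matrix (Fin m) (Fin m) ℂ) (i j : Fin m) : ‖X i j‖ ≤ ‖X‖ := by
  have h := norm_mulVec_apply_le X (Pi.single j 1) i
  have h1 : WithLp.toLp 2 (Pi.single j (1 : ℂ)) = EuclideanSpace.single j (1 : ℂ) := rfl
  rw [h1] at h
  simpa using h

lemma norm_trace_le (X : Matrix (Fin m) (Fin m) ℂ) : ‖X.trace‖ ≤ m * ‖X‖ := by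
  calc ‖X.trace‖ ≤ ∑ i, ‖X i i‖ := norm_sum_le _ _
    _ ≤ ∑ _i : Fin m, ‖X‖ := Finset.sum_le_sum fun i _ => norm_apply_le_l2_opNorm X i i
    _ = m * ‖X‖ := by simp

lemma exists_unitary_diagonalization (M : Matrix (Fin m) (Fin m) ℂ) :
    ∃ V ∈ Matrix.unitaryGroup (Fin m) ℂ, Vᴴ * (Mᴴ * M) * V = Matrix.diagonal fun j =>
      (((Matrix.isHermitian_conjTranspose_mul_self M).eigenvalues j : ℝ) : ℂ) := by
  set h := Matrix.isHermitian_conjTranspose_mul_self M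
  refine ⟨h.eigenvectorUnitary, h.eigenvectorUnitary.2, ?_⟩
  have := h.conjStarAlgAut_star_eigenvectorUnitary
  rw [Unitary.conjStarAlgAut_apply] at this
  simpa [Matrix.star_eq_conjTranspose, Function.comp_def] using this

lemma norm_le_one_of_mem_unitaryGroup {V : Matrix (Fin m) (Fin m) ℂ}
    (hV : V ∈ Matrix.unitaryGroup (Fin m) ℂ) : ‖V‖ ≤ 1 := by
  rcases subsingleton_or_nontrivial (Matrix (Fin m) (Fin m) ℂ) with _ | _
  · simp [Subsingleton.elim V 0]
  · exact (CStarRing.norm_of_mem_unitary hV).le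

/-- If `V` diagonalizes `Mᴴ M`, column `j` of `M V` has length `σⱼ(M)`, so each diagonal entry of
`(Vᴴ U)(M V)` is at most `‖U‖ σⱼ`. -/
theorem norm_trace_mul_le (U M : Matrix (Fin m) (Fin m) ℂ) :
    ‖(U * M).trace‖ ≤ ‖U‖ * traceNorm M := by
  obtain ⟨V, hV, hd⟩ := exists_unitary_diagonalization M
  have hVV : V * Vᴴ = 1 := Matrix.mem_unitaryGroup_iff.1 hV
  have hVn : ‖Vᴴ‖ ≤ 1 := by
    rw [Matrix.l2_opNorm_conjTranspose]; exact norm_le_one_of_mem_unitaryGroup hV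
  have htr : (U * M).trace = (Vᴴ * U * (M * V)).trace := by
    rw [Matrix.trace_mul_comm (Vᴴ * U), ← mul_assoc, mul_assoc M, hVV, mul_one,
      Matrix.trace_mul_comm]
  have hcol : ∀ j, ‖WithLp.toLp 2 ((M * V).col j)‖ =
      Real.sqrt ((Matrix.isHermitian_conjTranspose_mul_self M).eigenvalues j) := by
    intro j
    rw [EuclideanSpace.norm_eq]
    congr 1
    have h1 := congrFun (congrFun hd j) j
    rw [Matrix.diagonal_apply_eq,
      show Vᴴ * (Mᴴ * M) * V = (M * V)ᴴ * (M * V) by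
        rw [Matrix.conjTranspose_mul]; simp only [mul_assoc], Matrix.mul_apply] at h1
    have h2 : ((∑ i, ‖(M * V) i j‖ ^ 2 : ℝ) : ℂ) = ∑ i, (M * V)ᴴ j i * (M * V) i j := by
      push_cast
      refine Finset.sum_congr rfl fun i _ => ?_
      rw [Matrix.conjTranspose_apply, RCLike.star_def, RCLike.conj_mul]
      rfl
    rw [← h2] at h1
    simpa [Matrix.col_apply] using Complex.ofReal_injective h1
  rw [htr]
  calc ‖(Vᴴ * U * (M * V)).trace‖ ≤ ∑ j, ‖(Vᴴ * U * (M * V)) j j‖ := norm_sum_le _ _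
    _ ≤ ∑ j, ‖U‖ * Real.sqrt ((Matrix.isHermitian_conjTranspose_mul_self M).eigenvalues j) := by
        refine Finset.sum_le_sum fun j _ => ?_
        have h3 := norm_mulVec_apply_le (Vᴴ * U) ((M * V).col j) j
        rw [hcol j] at h3
        refine h3.trans ?_
        refine mul_le_mul_of_nonneg_right ?_ (Real.sqrt_nonneg _)
        exact (norm_mul_le _ _).trans (mul_le_of_le_one_left (norm_nonneg _) hVn)
    _ = ‖U‖ * traceNorm M := by rw [traceNorm, Finset.mul_sum]

/-- The maximizer is the adjoint of the partial isometry in the polar decomposition of `M`, namely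
`V S Vᴴ Mᴴ` with `S` the inverse singular values. -/
theorem exists_trace_mul_eq_traceNorm (M : Matrix (Fin m) (Fin m) ℂ) :
    ∃ U : Matrix (Fin m) (Fin m) ℂ, ‖U‖ ≤ 1 ∧ (U * M).trace = (traceNorm M : ℂ) := by
  obtain ⟨V, hV, hd⟩ := exists_unitary_diagonalization M
  set l := (Matrix.isHermitian_conjTranspose_mul_self M).eigenvalues with hl
  have hl0 : ∀ j, 0 ≤ l j := (Matrix.posSemidef_conjTranspose_mul_self M).eigenvalues_nonneg
  set S : Matrix (Fin m) (Fin m) ℂ := Matrix.diagonal fun j => (((Real.sqrt (l j))⁻¹ : ℝ) : ℂ)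
    with hS
  have hSt : Sᴴ = S := by
    rw [hS, Matrix.diagonal_conjTranspose]
    congr 1; ext j; simp
  have hVn : ‖V‖ ≤ 1 := norm_le_one_of_mem_unitaryGroup hV
  refine ⟨V * S * (Vᴴ * Mᴴ), ?_, ?_⟩
  · have h1 : ‖S * (Vᴴ * Mᴴ)‖ ≤ 1 := by
      have h2 : ‖S * (Vᴴ * Mᴴ)‖ * ‖S * (Vᴴ * Mᴴ)‖ ≤ 1 := by
        rw [← CStarRing.norm_self_mul_star, Matrix.star_eq_conjTranspose]
        have h3 : S * (Vᴴ * Mᴴ) * (S * (Vᴴ * Mᴴ))ᴴ = S * (Vᴴ * (Mᴴ * M) * V) * S := by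
          simp only [Matrix.conjTranspose_mul, Matrix.conjTranspose_conjTranspose, hSt, mul_assoc]
        rw [h3, hd, hS, Matrix.diagonal_mul_diagonal, Matrix.diagonal_mul_diagonal,
          Matrix.l2_opNorm_diagonal, pi_norm_le_iff_of_nonneg zero_le_one]
        intro j
        rw [← Complex.ofReal_mul, ← Complex.ofReal_mul, Complex.norm_real, Real.norm_eq_abs]
        -- Zero singular values are harmless because `0⁻¹ = 0`: the diagonal entry is then `0`
        -- instead of `1`.
        by_cases h0 : l j = 0
        · simp [h0]
        · have : Real.sqrt (l j) ≠ 0 := by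
            rw [Real.sqrt_ne_zero (hl0 j)]; exact h0
          have h4 : (Real.sqrt (l j))⁻¹ * l j * (Real.sqrt (l j))⁻¹ = 1 := by
            nth_rewrite 2 [← Real.mul_self_sqrt (hl0 j)]
            field_simp
          rw [h4, abs_one]
      nlinarith [norm_nonneg (S * (Vᴴ * Mᴴ))]
    rw [mul_assoc]
    exact (norm_mul_le _ _).trans (mul_le_one₀ hVn (norm_nonneg _) h1)
  · have h1 : (V * S * (Vᴴ * Mᴴ) * M).trace = (S * (Vᴴ * (Mᴴ * M) * V)).trace := by
      rw [mul_assoc V, mul_assoc V, Matrix.trace_mul_comm V]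
      simp only [mul_assoc]
    rw [h1, hd, hS, Matrix.diagonal_mul_diagonal, Matrix.trace_diagonal, traceNorm, ← hl]
    push_cast
    refine Finset.sum_congr rfl fun j _ => ?_
    rw [← Complex.ofReal_inv, ← Complex.ofReal_mul]
    congr 1
    rw [inv_mul_eq_div, Real.div_sqrt]

lemma traceNorm_nonneg (M : Matrix (Fin m) (Fin m) ℂ) : 0 ≤ traceNorm M :=
  Finset.sum_nonneg fun _ _ => Real.sqrt_nonneg _

lemma traceNorm_le_of_forall {M : Matrix (Fin m) (Fin m) ℂ} {c : ℝ}
    (h : ∀ U : Matrix (Fin m) (Fin m) ℂ, ‖U‖ ≤ 1 → ‖(U * M).trace‖ ≤ c) : traceNorm M ≤ c := by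
  obtain ⟨U, hU, hUM⟩ := exists_trace_mul_eq_traceNorm M
  have := h U hU
  rwa [hUM, Complex.norm_real, Real.norm_of_nonneg (traceNorm_nonneg M)] at this

lemma norm_trace_mul_le_traceNorm {U : Matrix (Fin m) (Fin m) ℂ} (hU : ‖U‖ ≤ 1)
    (M : Matrix (Fin m) (Fin m) ℂ) : ‖(U * M).trace‖ ≤ traceNorm M :=
  (norm_trace_mul_le U M).trans (mul_le_of_le_one_left (traceNorm_nonneg M) hU)

theorem traceNorm_add_le (M N : Matrix (Fin m) (Fin m) ℂ) :
    traceNorm (M + N) ≤ traceNorm M + traceNorm N := by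
  refine traceNorm_le_of_forall fun U hU => ?_
  rw [mul_add, Matrix.trace_add]
  exact (norm_add_le _ _).trans
    (add_le_add (norm_trace_mul_le_traceNorm hU M) (norm_trace_mul_le_traceNorm hU N))

lemma traceNorm_zero : traceNorm (0 : Matrix (Fin m) (Fin m) ℂ) = 0 :=
  le_antisymm (traceNorm_le_of_forall fun U _ => by simp) (traceNorm_nonneg _)

lemma traceNorm_sum_le {ι : Type*} (s : Finset ι) (f : ι → Matrix (Fin m) (Fin m) ℂ) :
    traceNorm (∑ i ∈ s, f i) ≤ ∑ i ∈ s, traceNorm (f i) :=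
  Finset.le_sum_of_subadditive _ traceNorm_zero.le traceNorm_add_le s f

lemma traceNorm_smul_le {c : ℝ} (hc : 0 ≤ c) (M : Matrix (Fin m) (Fin m) ℂ) :
    traceNorm (c • M) ≤ c * traceNorm M := by
  refine traceNorm_le_of_forall fun U hU => ?_
  rw [Matrix.mul_smul, Matrix.trace_smul, norm_smul, Real.norm_of_nonneg hc]
  exact mul_le_mul_of_nonneg_left (norm_trace_mul_le_traceNorm hU M) hc

/-- By cyclicity `Tr(U A M B) = Tr((B U A) M)`, so duality applies with `B U A` in place of `U`. -/
theorem traceNorm_mul_mul_le (A M B : Matrix (Fin m) (Fin m) ℂ) :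
    traceNorm (A * M * B) ≤ ‖A‖ * ‖B‖ * traceNorm M := by
  refine traceNorm_le_of_forall fun U hU => ?_
  rw [← mul_assoc, Matrix.trace_mul_comm, ← mul_assoc, ← mul_assoc]
  refine (norm_trace_mul_le _ M).trans (mul_le_mul_of_nonneg_right ?_ (traceNorm_nonneg M))
  calc ‖B * U * A‖ ≤ ‖B * U‖ * ‖A‖ := norm_mul_le _ _
    _ ≤ ‖B‖ * ‖A‖ := by
        refine mul_le_mul_of_nonneg_right ?_ (norm_nonneg _)
        exact (norm_mul_le _ _).trans (mul_le_of_le_one_right (norm_nonneg _) hU)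
    _ = ‖A‖ * ‖B‖ := mul_comm _ _

theorem traceNorm_le_mul_norm (M : Matrix (Fin m) (Fin m) ℂ) : traceNorm M ≤ m * ‖M‖ := by
  refine traceNorm_le_of_forall fun U hU => (norm_trace_le _).trans ?_
  refine mul_le_mul_of_nonneg_left ?_ (Nat.cast_nonneg m)
  exact (norm_mul_le _ _).trans (mul_le_of_le_one_left (norm_nonneg _) hU)

/-- The operator norm is dominated by the trace norm: the largest eigenvalue of `Mᴴ M` is one of
the summands of the trace norm. -/
theorem norm_le_traceNorm (M : Matrix (Fin m) (Fin m) ℂ) : ‖M‖ ≤ traceNorm M := by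
  obtain ⟨V, hV, hd⟩ := exists_unitary_diagonalization M
  set l := (Matrix.isHermitian_conjTranspose_mul_self M).eigenvalues with hl
  have hl0 : ∀ j, 0 ≤ l j := (Matrix.posSemidef_conjTranspose_mul_self M).eigenvalues_nonneg
  have hVV : V * Vᴴ = 1 := Matrix.mem_unitaryGroup_iff.1 hV
  have hVn : ‖V‖ ≤ 1 := norm_le_one_of_mem_unitaryGroup hV
  have hVn' : ‖Vᴴ‖ ≤ 1 := by rwa [Matrix.l2_opNorm_conjTranspose]
  have h1 : Mᴴ * M = V * (Vᴴ * (Mᴴ * M) * V) * Vᴴ := by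
    calc Mᴴ * M = (V * Vᴴ) * (Mᴴ * M) * (V * Vᴴ) := by rw [hVV, one_mul, mul_one]
      _ = _ := by simp only [mul_assoc]
  have h2 : ‖Mᴴ * M‖ ≤ traceNorm M ^ 2 := by
    rw [h1, hd]
    have h3 : ‖Matrix.diagonal fun j => ((l j : ℝ) : ℂ)‖ ≤ traceNorm M ^ 2 := by
      rw [Matrix.l2_opNorm_diagonal, pi_norm_le_iff_of_nonneg (sq_nonneg _)]
      intro j
      rw [Complex.norm_real, Real.norm_of_nonneg (hl0 j), ← Real.sq_sqrt (hl0 j)]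
      refine pow_le_pow_left₀ (Real.sqrt_nonneg _) ?_ 2
      exact Finset.single_le_sum (f := fun j => Real.sqrt (l j))
        (fun i _ => Real.sqrt_nonneg _) (Finset.mem_univ j)
    refine (norm_mul_le _ _).trans ((mul_le_of_le_one_right (norm_nonneg _) hVn').trans ?_)
    exact (norm_mul_le _ _).trans ((mul_le_of_le_one_left (norm_nonneg _) hVn).trans h3)
  rw [Matrix.l2_opNorm_conjTranspose_mul_self] at h2
  exact abs_le_of_sq_le_sq' (by rw [sq]; exact h2) (traceNorm_nonneg M) |>.2

end TraceNorm

end Lindblad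

namespace Lindblad

/-! ### Contractivity of dissipative semigroups -/

section Contraction

variable {m : ℕ}

/-- Only an inequality, since the norm is `0` when `m = 0`. -/
lemma norm_one_le : ‖(1 : Matrix (Fin m) (Fin m) ℂ)‖ ≤ 1 :=
  norm_le_one_of_mem_unitaryGroup (one_mem _)

open scoped MatrixOrder in
lemma norm_le_one_of_posSemidef_one_sub {E : Matrix (Fin m) (Fin m) ℂ}
    (h : (1 - Eᴴ * E).PosSemidef) : ‖E‖ ≤ 1 := by
  have h1 : ‖Eᴴ * E‖ ≤ ‖(1 : Matrix (Fin m) (Fin m) ℂ)‖ :=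
    CStarAlgebra.norm_le_norm_of_nonneg_of_le
      (Matrix.nonneg_iff_posSemidef.2 (Matrix.posSemidef_conjTranspose_mul_self E))
      (Matrix.le_iff.2 h)
  have h2 := h1.trans norm_one_le
  rw [Matrix.l2_opNorm_conjTranspose_mul_self] at h2
  nlinarith [norm_nonneg E]

/-- The real part of the quadratic form of a matrix at a fixed vector. -/
def quadForm (x : Fin m → ℂ) : Matrix (Fin m) (Fin m) ℂ →ₗ[ℝ] ℝ where
  toFun X := (star x ⬝ᵥ (X *ᵥ x)).re
  map_add' X Y := by simp [Matrix.add_mulVec, dotProduct_add]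
  map_smul' c X := by simp [Matrix.smul_mulVec, dotProduct_smul]

/-- The semigroup generated by a dissipative matrix is contractive. -/
theorem norm_exp_smul_le_one {A : Matrix (Fin m) (Fin m) ℂ} (hA : (-(A + Aᴴ)).PosSemidef)
    {τ : ℝ} (hτ : 0 ≤ τ) : ‖NormedSpace.exp (τ • A)‖ ≤ 1 := by
  have hct : ∀ t : ℝ, (NormedSpace.exp (t • A))ᴴ = NormedSpace.exp (t • Aᴴ) := fun t => by
    rw [← Matrix.exp_conjTranspose, Matrix.conjTranspose_smul, star_trivial]
  apply norm_le_one_of_posSemidef_one_sub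
  refine Matrix.PosSemidef.of_dotProduct_mulVec_nonneg ?_ fun x => ?_
  · exact Matrix.isHermitian_one.sub (Matrix.isHermitian_conjTranspose_mul_self _)
  have hH : (1 - (NormedSpace.exp (τ • A))ᴴ * NormedSpace.exp (τ • A)).IsHermitian :=
    Matrix.isHermitian_one.sub (Matrix.isHermitian_conjTranspose_mul_self _)
  have him := hH.im_star_dotProduct_mulVec_self x
  rw [Complex.nonneg_iff]
  refine ⟨?_, him.symm⟩
  let ℓ := LinearMap.toContinuousLinearMap (quadForm x)
  -- `g t = ‖e^{tA} x‖²`; its derivative is the quadratic form of `A + Aᴴ` at `e^{tA} x`, hence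
  -- nonpositive.
  let g : ℝ → ℝ := fun t => ℓ (NormedSpace.exp (t • Aᴴ) * NormedSpace.exp (t • A))
  have hg : ∀ t, HasDerivAt g (ℓ (NormedSpace.exp (t • Aᴴ) * (A + Aᴴ) * NormedSpace.exp (t • A)))
      t := by
    intro t
    have h := (hasDerivAt_exp_smul_const Aᴴ t).mul (hasDerivAt_exp_smul_const' A t)
    have h2 := ℓ.hasFDerivAt.comp_hasDerivAt t h
    have h3 : NormedSpace.exp (t • Aᴴ) * Aᴴ * NormedSpace.exp (t • A)
        + NormedSpace.exp (t • Aᴴ) * (A * NormedSpace.exp (t • A))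
        = NormedSpace.exp (t • Aᴴ) * (A + Aᴴ) * NormedSpace.exp (t • A) := by noncomm_ring
    rw [h3] at h2
    exact h2
  have hanti : AntitoneOn g (Set.Ici 0) := by
    refine antitoneOn_of_deriv_nonpos (convex_Ici 0)
      (fun t _ => (hg t).continuousAt.continuousWithinAt)
      (fun t _ => (hg t).differentiableAt.differentiableWithinAt) fun t _ => ?_
    rw [(hg t).deriv, ← hct]
    have h := (hA.conjTranspose_mul_mul_same (NormedSpace.exp (t • A))).re_dotProduct_nonneg x
    have h3 : ℓ ((NormedSpace.exp (t • A))ᴴ * (A + Aᴴ) * NormedSpace.exp (t • A)) =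
        - ℓ ((NormedSpace.exp (t • A))ᴴ * (-(A + Aᴴ)) * NormedSpace.exp (t • A)) := by
      rw [← map_neg]; congr 1; noncomm_ring
    rw [h3]
    exact neg_nonpos.2 h
  have h0 := hanti (Set.mem_Ici.2 le_rfl) (Set.mem_Ici.2 hτ) hτ
  have h1 : g 0 = ℓ 1 := by simp [g]
  have h2 : g τ = ℓ ((NormedSpace.exp (τ • A))ᴴ * NormedSpace.exp (τ • A)) := by rw [hct]
  rw [h1, h2] at h0
  have h4 : 0 ≤ ℓ (1 - (NormedSpace.exp (τ • A))ᴴ * NormedSpace.exp (τ • A)) := by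
    rw [map_sub]; linarith
  exact h4

end Contraction

/-! ### Stability of the scheme and error propagation -/

section Stability

variable {m K : ℕ} {T : ℝ} {H : ℝ → Matrix (Fin m) (Fin m) ℂ}
  {L : Fin K → Matrix (Fin m) (Fin m) ℂ} {γ : Fin K → ℝ → ℝ}

/-- The Hamiltonian part `-iH` is skew-Hermitian and cancels, leaving `∑ γₖ Lₖᴴ Lₖ`. -/
lemma posSemidef_neg_opA_add_conjTranspose {t : ℝ} (hH : (H t).IsHermitian)
    (hγ : ∀ k, 0 ≤ γ k t) : (-(opA H L γ t + (opA H L γ t)ᴴ)).PosSemidef := by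
  have h : -(opA H L γ t + (opA H L γ t)ᴴ) = ∑ k, γ k t • ((L k)ᴴ * L k) := by
    simp only [opA, Matrix.conjTranspose_sub, Matrix.conjTranspose_neg, Matrix.conjTranspose_smul,
      hH.eq, Matrix.conjTranspose_sum, star_trivial, Matrix.conjTranspose_mul,
      Matrix.conjTranspose_conjTranspose, Complex.star_def, Complex.conj_I]
    module
  rw [h]
  exact Matrix.posSemidef_sum _ fun k _ =>
    (Matrix.posSemidef_conjTranspose_mul_self (L k)).smul (hγ k)

lemma norm_exp_conjTranspose (A : Matrix (Fin m) (Fin m) ℂ) (τ : ℝ) :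
    ‖NormedSpace.exp (τ • Aᴴ)‖ = ‖NormedSpace.exp (τ • A)‖ := by
  rw [← Matrix.l2_opNorm_conjTranspose (NormedSpace.exp (τ • A)), ← Matrix.exp_conjTranspose,
    Matrix.conjTranspose_smul, star_trivial]

lemma traceNorm_exp_conj_le {A : Matrix (Fin m) (Fin m) ℂ} {τ : ℝ}
    (hA : ‖NormedSpace.exp (τ • A)‖ ≤ 1) (p : Matrix (Fin m) (Fin m) ℂ) :
    traceNorm (NormedSpace.exp (τ • Aᴴ) * p * NormedSpace.exp (τ • A)) ≤ traceNorm p := by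
  refine (traceNorm_mul_mul_le _ _ _).trans (mul_le_of_le_one_left (traceNorm_nonneg p) ?_)
  rw [norm_exp_conjTranspose]
  exact mul_le_one₀ hA (norm_nonneg _) hA

lemma traceNorm_jump_le (B p : Matrix (Fin m) (Fin m) ℂ) :
    traceNorm (Bᴴ * p * B) ≤ traceNorm B ^ 2 * traceNorm p := by
  refine (traceNorm_mul_mul_le _ _ _).trans
    (mul_le_mul_of_nonneg_right ?_ (traceNorm_nonneg p))
  rw [Matrix.l2_opNorm_conjTranspose, ← sq]
  exact pow_le_pow_left₀ (norm_nonneg _) (norm_le_traceNorm B) 2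

/-- `X` is left free so that the bound serves both the bare jump sum of the half step and the
conjugated one of the full step. -/
lemma traceNorm_sum_smul_le {t : ℝ} (ht : t ∈ Set.Icc 0 T) (hγ : ∀ k, 0 ≤ γ k t)
    (hb : ∀ k, BddAbove (γ k '' Set.Icc (0 : ℝ) T)) {c : ℝ}
    {X : Fin K → Matrix (Fin m) (Fin m) ℂ} (hX : ∀ k, traceNorm (X k) ≤ traceNorm (L k) ^ 2 * c) :
    traceNorm (∑ k, γ k t • X k) ≤ constC₂ T L γ * c := by
  rw [constC₂, Finset.sum_mul]
  refine (traceNorm_sum_le _ _).trans (Finset.sum_le_sum fun k _ => ?_)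
  have h1 : γ k t ≤ sSup (γ k '' Set.Icc (0 : ℝ) T) := le_csSup (hb k) ⟨t, ht, rfl⟩
  calc traceNorm (γ k t • X k) ≤ γ k t * traceNorm (X k) := traceNorm_smul_le (hγ k) _
    _ ≤ sSup (γ k '' Set.Icc (0 : ℝ) T) * (traceNorm (L k) ^ 2 * c) :=
        mul_le_mul h1 (hX k) (traceNorm_nonneg _) ((hγ k).trans h1)
    _ = _ := by ring

lemma constC₂_nonneg (hγ : ∀ k, ∀ t ∈ Set.Icc (0 : ℝ) T, 0 ≤ γ k t) :
    0 ≤ constC₂ T L γ :=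
  Finset.sum_nonneg fun k _ => mul_nonneg
    (Real.sSup_nonneg (by rintro _ ⟨t, ht, rfl⟩; exact hγ k t ht)) (sq_nonneg _)

/-- Stability of one step of the scheme in the trace norm. -/
theorem traceNorm_backwardStep_le {τ t : ℝ} (hτ : 0 ≤ τ) (ht : t ∈ Set.Icc 0 T)
    (hs : t - τ / 2 ∈ Set.Icc 0 T)
    (hH : ∀ t ∈ Set.Icc (0 : ℝ) T, (H t).IsHermitian)
    (hγ : ∀ k, ∀ t ∈ Set.Icc (0 : ℝ) T, 0 ≤ γ k t)
    (hb : ∀ k, BddAbove (γ k '' Set.Icc (0 : ℝ) T)) (p : Matrix (Fin m) (Fin m) ℂ) :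
    traceNorm (backwardStep H L γ τ t p) ≤ Real.exp (constC₂ T L γ * τ) * traceNorm p := by
  have hC := constC₂_nonneg (L := L) hγ
  set C := constC₂ T L γ
  have hp := traceNorm_nonneg p
  have hexp : ∀ u ∈ Set.Icc (0 : ℝ) T, ∀ σ : ℝ, 0 ≤ σ →
      ‖NormedSpace.exp (σ • opA H L γ u)‖ ≤ 1 := fun u hu σ hσ =>
    norm_exp_smul_le_one (posSemidef_neg_opA_add_conjTranspose (hH u hu) fun k => hγ k u hu) hσ
  have hhalf : traceNorm (halfStep H L γ τ t p) ≤ (1 + τ / 2 * C) * traceNorm p := by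
    refine (traceNorm_exp_conj_le (hexp t ht _ (by positivity)) _).trans ?_
    have h1 : traceNorm (∑ k, γ k t • ((L k)ᴴ * p * L k)) ≤ C * traceNorm p :=
      traceNorm_sum_smul_le ht (fun k => hγ k t ht) hb fun k => traceNorm_jump_le (L k) p
    calc _ ≤ traceNorm p + traceNorm ((τ / 2) • ∑ k, γ k t • ((L k)ᴴ * p * L k)) :=
          traceNorm_add_le _ _
      _ ≤ traceNorm p + τ / 2 * (C * traceNorm p) :=
          add_le_add le_rfl ((traceNorm_smul_le (by positivity) _).trans
            (mul_le_mul_of_nonneg_left h1 (by positivity)))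
      _ = _ := by ring
  have hsum := traceNorm_sum_smul_le hs (fun k => hγ k _ hs) hb
    (X := fun k => NormedSpace.exp ((τ / 2) • (opA H L γ (t - τ / 2))ᴴ)
          * ((L k)ᴴ * halfStep H L γ τ t p * L k)
          * NormedSpace.exp ((τ / 2) • opA H L γ (t - τ / 2))) fun k =>
      (traceNorm_exp_conj_le (hexp _ hs _ (by positivity)) _).trans
        ((traceNorm_jump_le (L k) _).trans (mul_le_mul_of_nonneg_left hhalf (sq_nonneg _)))
  calc traceNorm (backwardStep H L γ τ t p)
      ≤ traceNorm p + τ * (C * ((1 + τ / 2 * C) * traceNorm p)) :=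
        (traceNorm_add_le _ _).trans (add_le_add (traceNorm_exp_conj_le (hexp _ hs _ hτ) p)
          ((traceNorm_smul_le hτ _).trans (mul_le_mul_of_nonneg_left hsum hτ)))
    _ = (1 + C * τ + (C * τ) ^ 2 / 2) * traceNorm p := by ring
    _ ≤ _ := mul_le_mul_of_nonneg_right (Real.quadratic_le_exp_of_nonneg (by positivity)) hp

lemma halfStep_sub (τ t : ℝ) (p p' : Matrix (Fin m) (Fin m) ℂ) :
    halfStep H L γ τ t (p - p') = halfStep H L γ τ t p - halfStep H L γ τ t p' := by
  simp only [halfStep, mul_sub, sub_mul, smul_sub, Finset.sum_sub_distrib, mul_add, add_mul]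
  abel

/-- Linearity lets the one-step stability bound act on the error itself. -/
lemma backwardStep_sub (τ t : ℝ) (p p' : Matrix (Fin m) (Fin m) ℂ) :
    backwardStep H L γ τ t (p - p') = backwardStep H L γ τ t p - backwardStep H L γ τ t p' := by
  simp only [backwardStep, halfStep_sub, mul_sub, sub_mul, smul_sub, Finset.sum_sub_distrib]
  abel

/-- Discrete Grönwall estimate for a backward recursion with geometric amplification. -/
lemma le_of_backward_recursion {N : ℕ} {e : ℕ → ℝ} {r δ : ℝ} (hr : 0 ≤ r) (hN : e N ≤ 0)
    (h : ∀ n < N, e n ≤ δ + r * e (n + 1)) (j : ℕ) (hj : j ≤ N) :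
    e (N - j) ≤ δ * ∑ i ∈ Finset.range j, r ^ i := by
  induction j with
  | zero => simpa using hN
  | succ j ih =>
    have h1 := h (N - (j + 1)) (by omega)
    rw [show N - (j + 1) + 1 = N - j by omega] at h1
    refine h1.trans ?_
    have h2 := mul_le_mul_of_nonneg_left (ih (by omega)) hr
    rw [Finset.sum_range_succ', pow_zero]
    simp only [pow_succ, ← Finset.sum_mul]
    linarith

/-- The sum times `e^{Cτ} - 1 ≥ Cτ` telescopes to `e^{jCτ} - 1 ≤ e^{CT} - 1`; one power of `τ` is
lost. For `C = 0` the sum is `j ≤ N`. -/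
lemma mul_geom_sum_le_constC₃ {C C₁ : ℝ} (hT : 0 < T) (hC : 0 ≤ C) (hC₁ : 0 < C₁) {N j : ℕ}
    (hN : 1 ≤ N) (hj : j ≤ N) :
    C₁ * (T / N) ^ 3 * ∑ i ∈ Finset.range j, Real.exp (C * (T / N)) ^ i
      ≤ constC₃ T C₁ C * (T / N) ^ 2 := by
  have hN0 : (0 : ℝ) < N := by exact_mod_cast hN
  have hτ : 0 < T / N := by positivity
  have hNτ : (N : ℝ) * (T / N) = T := by field_simp
  have hjN : (j : ℝ) ≤ N := by exact_mod_cast hj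
  set τ := T / N
  rw [constC₃]
  split_ifs with h0
  · simp only [h0, zero_mul, Real.exp_zero, one_pow, Finset.sum_const, Finset.card_range,
      nsmul_eq_mul, mul_one]
    calc C₁ * τ ^ 3 * j ≤ C₁ * τ ^ 3 * N := mul_le_mul_of_nonneg_left hjN (by positivity)
      _ = (N * τ) * C₁ * τ ^ 2 := by ring
      _ = T * C₁ * τ ^ 2 := by rw [hNτ]
  · have hC' : 0 < C := lt_of_le_of_ne hC (Ne.symm h0)
    have hx : 0 < C * τ := by positivity
    have hgeom := geom_sum_mul (Real.exp (C * τ)) j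
    have h1 : C * τ ≤ Real.exp (C * τ) - 1 := by linarith [Real.add_one_le_exp (C * τ)]
    have h2 : Real.exp (C * τ) ^ j ≤ Real.exp (C * T) := by
      rw [← Real.exp_nat_mul]
      apply Real.exp_le_exp.2
      calc (j : ℝ) * (C * τ) ≤ N * (C * τ) := mul_le_mul_of_nonneg_right hjN hx.le
        _ = C * (N * τ) := by ring
        _ = C * T := by rw [hNτ]
    set S := ∑ i ∈ Finset.range j, Real.exp (C * τ) ^ i
    have hS : 0 ≤ S := Finset.sum_nonneg fun i _ => by positivity
    have h3 : S * (C * τ) ≤ Real.exp (C * T) - 1 := by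
      calc S * (C * τ) ≤ S * (Real.exp (C * τ) - 1) := mul_le_mul_of_nonneg_left h1 hS
        _ ≤ _ := by rw [hgeom]; linarith
    rw [div_mul_eq_mul_div, le_div_iff₀ hC']
    calc C₁ * τ ^ 3 * S * C = (S * (C * τ)) * (C₁ * τ ^ 2) := by ring
      _ ≤ (Real.exp (C * T) - 1) * (C₁ * τ ^ 2) :=
          mul_le_mul_of_nonneg_right h3 (by positivity)
      _ = _ := by ring

lemma constC₃_pos {C C₁ : ℝ} (hT : 0 < T) (hC : 0 ≤ C) (hC₁ : 0 < C₁) : 0 < constC₃ T C₁ C := by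
  rw [constC₃]
  split_ifs with h0
  · positivity
  · have hC' : 0 < C := lt_of_le_of_ne hC (Ne.symm h0)
    have : 0 < Real.exp (C * T) - 1 := by
      linarith [Real.add_one_le_exp (C * T), mul_pos hC' hT]
    positivity

lemma grid_mem {τ t : ℝ} (hτ : 0 < τ) (h1 : τ ≤ t) (h2 : t ≤ T) :
    t ∈ Set.Icc 0 T ∧ t - τ / 2 ∈ Set.Icc 0 T ∧ t - τ ∈ Set.Icc 0 T :=
  ⟨⟨by linarith, h2⟩, ⟨by linarith, by linarith⟩, ⟨by linarith, by linarith⟩⟩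

lemma step_le_grid {N n : ℕ} (hT : 0 < T) (hn : n < N) :
    0 < T / N ∧ T / N ≤ ((n + 1 : ℕ) : ℝ) * (T / N) ∧ ((n + 1 : ℕ) : ℝ) * (T / N) ≤ T := by
  have hN0 : (0 : ℝ) < N := by exact_mod_cast (by omega : 0 < N)
  have hτ : 0 < T / N := by positivity
  have h1 : (1 : ℝ) ≤ ((n + 1 : ℕ) : ℝ) := by exact_mod_cast (by omega : 1 ≤ n + 1)
  have h2 : ((n + 1 : ℕ) : ℝ) ≤ N := by exact_mod_cast hn
  refine ⟨hτ, by nlinarith, ?_⟩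
  calc ((n + 1 : ℕ) : ℝ) * (T / N) ≤ N * (T / N) := mul_le_mul_of_nonneg_right h2 hτ.le
    _ = T := by field_simp

/-- Consistency and stability of the scheme imply second-order convergence. -/
theorem traceNorm_error_le {Q : Matrix (Fin m) (Fin m) ℂ} {q : ℝ → Matrix (Fin m) (Fin m) ℂ}
    (hT : 0 < T) (hH : ∀ t ∈ Set.Icc (0 : ℝ) T, (H t).IsHermitian)
    (hγ : ∀ k, ∀ t ∈ Set.Icc (0 : ℝ) T, 0 ≤ γ k t)
    (hb : ∀ k, BddAbove (γ k '' Set.Icc (0 : ℝ) T)) (hqT : q T = Q) {C₁ : ℝ}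
    (hC₁ : IsConsistencyConst T H L γ q C₁) {N : ℕ} (hN : 1 ≤ N)
    {x : ℕ → Matrix (Fin m) (Fin m) ℂ} (hx : IsBackwardFREM T H L γ Q N x) {n : ℕ} (hn : n ≤ N) :
    traceNorm (q ((n : ℝ) * (T / N)) - x n)
      ≤ constC₃ T C₁ (constC₂ T L γ) * (T / N) ^ 2 := by
  have hN0 : (N : ℝ) ≠ 0 := by exact_mod_cast (by omega : N ≠ 0)
  have hend : traceNorm (q ((N : ℝ) * (T / N)) - x N) ≤ 0 := by
    rw [mul_div_cancel₀ T hN0, hqT, hx.1, sub_self, traceNorm_zero]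
  have hrec : ∀ n < N, traceNorm (q ((n : ℝ) * (T / N)) - x n) ≤ C₁ * (T / N) ^ 3 +
      Real.exp (constC₂ T L γ * (T / N)) *
        traceNorm (q (((n + 1 : ℕ) : ℝ) * (T / N)) - x (n + 1)) := by
    intro n hn
    obtain ⟨hτ, h1, h2⟩ := step_le_grid hT hn
    obtain ⟨ht, hs, -⟩ := grid_mem hτ h1 h2
    -- Local error plus propagated error.
    have heq : q ((n : ℝ) * (T / N)) - x n = truncError T H L γ q N n +
        backwardStep H L γ (T / N) (((n + 1 : ℕ) : ℝ) * (T / N))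
          (q (((n + 1 : ℕ) : ℝ) * (T / N)) - x (n + 1)) := by
      rw [backwardStep_sub, ← hx.2 n hn, truncError]
      abel
    rw [heq]
    exact (traceNorm_add_le _ _).trans (add_le_add (hC₁.2 N hN n hn)
      (traceNorm_backwardStep_le hτ.le ht hs hH hγ hb _))
  have := le_of_backward_recursion (e := fun n => traceNorm (q ((n : ℝ) * (T / N)) - x n))
    (Real.exp_nonneg _) hend hrec (N - n) (by omega)
  rw [show N - (N - n) = n by omega] at this
  exact this.trans (mul_geom_sum_le_constC₃ hT (constC₂_nonneg hγ) hC₁.1 hN (by omega))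

end Stability

end Lindblad

open Asymptotics Filter

namespace Lindblad

/-! ### Taylor remainders on an interval with one-sided derivatives -/

section Taylor

variable {E : Type*} [NormedAddCommGroup E] [NormedSpace ℝ E] {T C : ℝ} {f f₁ f₂ f₃ : ℝ → E}

/-- Mean value inequality on the segment from `a` to `x`. It raises the order by one without the
factor `1/(k+1)`; iterated, it yields Taylor bounds with non-sharp constants. -/
lemma norm_sub_le_pow_succ {a x : ℝ} {k : ℕ}
    (hf : ∀ t ∈ Set.Icc 0 T, HasDerivWithinAt f (f₁ t) (Set.Icc 0 T) t) (hC : 0 ≤ C)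
    (ha : a ∈ Set.Icc 0 T) (hx : x ∈ Set.Icc 0 T)
    (hb : ∀ t ∈ Set.Icc 0 T, ‖f₁ t‖ ≤ C * |t - a| ^ k) : ‖f x - f a‖ ≤ C * |x - a| ^ (k + 1) := by
  have hsub : Set.uIcc a x ⊆ Set.Icc 0 T := Set.uIcc_subset_Icc ha hx
  have h := (convex_uIcc a x).norm_image_sub_le_of_norm_hasDerivWithin_le (C := C * |x - a| ^ k)
    (fun t ht => (hf t (hsub ht)).mono hsub)
    (fun t ht => (hb t (hsub ht)).trans (mul_le_mul_of_nonneg_left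
      (pow_le_pow_left₀ (abs_nonneg _) (Set.abs_sub_left_of_mem_uIcc ht) k) hC))
    Set.left_mem_uIcc Set.right_mem_uIcc
  rwa [Real.norm_eq_abs, mul_assoc, ← pow_succ] at h

lemma norm_sub_taylor_one_le {a x : ℝ} {k : ℕ}
    (hf : ∀ t ∈ Set.Icc 0 T, HasDerivWithinAt f (f₁ t) (Set.Icc 0 T) t) (hC : 0 ≤ C)
    (ha : a ∈ Set.Icc 0 T) (hx : x ∈ Set.Icc 0 T)
    (hb : ∀ t ∈ Set.Icc 0 T, ‖f₁ t - f₁ a‖ ≤ C * |t - a| ^ k) :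
    ‖f x - f a - (x - a) • f₁ a‖ ≤ C * |x - a| ^ (k + 1) := by
  have h := norm_sub_le_pow_succ (f := fun t => f t - (t - a) • f₁ a)
    (f₁ := fun t => f₁ t - f₁ a) (T := T) (fun t ht => by
      have h1 := ((hasDerivAt_id t).sub_const a).smul_const (f₁ a)
      have h2 := (hf t ht).sub h1.hasDerivWithinAt
      exact h2.congr_deriv (by simp)) hC ha hx hb
  have h3 : f x - f a - (x - a) • f₁ a = (f x - (x - a) • f₁ a) - (f a - (a - a) • f₁ a) := by
    module
  rwa [h3]

/-- The derivative of the remainder of `f` is the first-order remainder of `f₁`. -/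
lemma norm_sub_taylor_two_le {a x : ℝ}
    (hf : ∀ t ∈ Set.Icc 0 T, HasDerivWithinAt f (f₁ t) (Set.Icc 0 T) t)
    (hf₁ : ∀ t ∈ Set.Icc 0 T, HasDerivWithinAt f₁ (f₂ t) (Set.Icc 0 T) t)
    (hf₂ : ∀ t ∈ Set.Icc 0 T, HasDerivWithinAt f₂ (f₃ t) (Set.Icc 0 T) t) (hC : 0 ≤ C)
    (ha : a ∈ Set.Icc 0 T) (hx : x ∈ Set.Icc 0 T) (hb : ∀ t ∈ Set.Icc 0 T, ‖f₃ t‖ ≤ C) :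
    ‖f x - f a - (x - a) • f₁ a - ((x - a) ^ 2 / 2) • f₂ a‖ ≤ C * |x - a| ^ 3 := by
  have h := norm_sub_le_pow_succ (k := 2)
    (f := fun t => f t - (t - a) • f₁ a - ((t - a) ^ 2 / 2) • f₂ a)
    (f₁ := fun t => f₁ t - f₁ a - (t - a) • f₂ a) (T := T) (fun t ht => by
      have h1 := ((hasDerivAt_id t).sub_const a).smul_const (f₁ a)
      have h1' := ((((hasDerivAt_id t).sub_const a).pow 2).div_const 2).smul_const (f₂ a)
      have h2 := ((hf t ht).sub h1.hasDerivWithinAt).sub h1'.hasDerivWithinAt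
      exact h2.congr_deriv (by simp)) hC ha hx
    (fun t ht => norm_sub_taylor_one_le hf₁ hC ha ht fun y hy => by
      simpa using norm_sub_le_pow_succ (k := 0) hf₂ hC ha hy (by simpa using hb))
  have h3 : f x - f a - (x - a) • f₁ a - ((x - a) ^ 2 / 2) • f₂ a
      = (f x - (x - a) • f₁ a - ((x - a) ^ 2 / 2) • f₂ a)
        - (f a - (a - a) • f₁ a - ((a - a) ^ 2 / 2) • f₂ a) := by
    simp only [sub_self]
    module
  rwa [h3]

end Taylor

/-! ### Uniform bounds written as `O` over principal filters -/

section BigO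

variable {α E F : Type*} [NormedAddCommGroup E] [NormedAddCommGroup F] [NormedSpace ℝ F]
  {S : Set α} {T : ℝ} {u v : α → ℝ}

/-- Over `𝓟 S`, `O` means one constant valid on all of `S`, with no limit taken; hence constants
independent of `N` and `n`. -/
lemma isBigO_principal_one_of_continuousOn {f : ℝ → E} (hf : ContinuousOn f (Set.Icc 0 T))
    (hu : ∀ x ∈ S, u x ∈ Set.Icc 0 T) : (fun x => f (u x)) =O[𝓟 S] fun _ => (1 : ℝ) := by
  obtain ⟨C, hC⟩ := isCompact_Icc.exists_bound_of_continuousOn hf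
  exact isBigO_principal.2 ⟨C, fun x hx => by simpa using hC _ (hu x hx)⟩

variable [NormedSpace ℝ E]

lemma isBigO_clm_apply {l : Filter α} {f : α → E →L[ℝ] F} {x : α → E} {g₁ g₂ : α → ℝ}
    (hf : f =O[l] g₁) (hx : x =O[l] g₂) : (fun y => f y (x y)) =O[l] fun y => g₁ y * g₂ y :=
  (isBigO_of_le l fun y => by
    simpa using (f y).le_opNorm (x y)).trans (hf.norm_left.mul hx.norm_left)

lemma isBigO_principal_sub_of_contDiffOn {f : ℝ → E} (hT : 0 < T)
    (hf : ContDiffOn ℝ 1 f (Set.Icc 0 T)) (hu : ∀ x ∈ S, u x ∈ Set.Icc 0 T)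
    (hv : ∀ x ∈ S, v x ∈ Set.Icc 0 T) :
    (fun x => f (u x) - f (v x)) =O[𝓟 S] fun x => u x - v x := by
  have hd := (contDiffOn_one_iff_derivWithin (uniqueDiffOn_Icc hT)).1 hf
  obtain ⟨C, hC⟩ := isCompact_Icc.exists_bound_of_continuousOn hd.2
  refine isBigO_principal.2 ⟨C, fun x hx => ?_⟩
  exact (convex_Icc 0 T).norm_image_sub_le_of_norm_hasDerivWithin_le
    (fun t ht => (hd.1 t ht).hasDerivWithinAt) hC (hv x hx) (hu x hx)

end BigO

/-! ### Expansions in a normed algebra -/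

section Expansion

variable {α B : Type*} [NormedRing B] {l : Filter α} {τ : α → ℝ}

lemma isBigO_mul_sub_mul {f f' g g' : α → B} {r : α → ℝ}
    (hf : (fun x => f x - f' x) =O[l] r) (hg : (fun x => g x - g' x) =O[l] r)
    (hg1 : g =O[l] fun _ => (1 : ℝ)) (hf1 : f' =O[l] fun _ => (1 : ℝ)) :
    (fun x => f x * g x - f' x * g' x) =O[l] r := by
  have h := (hf.mul hg1).add ((hf1.mul hg).congr_right fun x => by rw [one_mul, mul_one])
  simp only [mul_one] at h
  refine h.congr_left fun x => ?_
  noncomm_ring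

lemma isBigO_one_of_sub {f f' : α → B} {r : α → ℝ} (hr : r =O[l] fun _ => (1 : ℝ))
    (h : (fun x => f x - f' x) =O[l] r) (h' : f' =O[l] fun _ => (1 : ℝ)) :
    f =O[l] fun _ => (1 : ℝ) :=
  ((h.trans hr).add h').congr_left fun x => by abel

variable [NormedAlgebra ℝ B]

lemma isBigO_pow_one (hτ : τ =O[l] fun _ => (1 : ℝ)) (n : ℕ) :
    (fun x => τ x ^ n) =O[l] fun _ => (1 : ℝ) := by simpa using hτ.pow n

lemma isBigO_pow_smul {f : α → B} (hf : f =O[l] fun _ => (1 : ℝ)) (c : ℝ) (n : ℕ) :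
    (fun x => (τ x ^ n * c) • f x) =O[l] fun x => τ x ^ n := by
  have h : (fun x => τ x ^ n * c) =O[l] fun x => τ x ^ n :=
    (isBigO_refl _ l).mul (isBigO_const_const c one_ne_zero l) |>.congr_right fun x => mul_one _
  simpa using h.smul hf

lemma isBigO_taylor_one {a : α → B} (hτ : τ =O[l] fun _ => (1 : ℝ))
    (ha : a =O[l] fun _ => (1 : ℝ)) (c : ℝ) :
    (fun x => 1 + (τ x * c) • a x) =O[l] fun _ => (1 : ℝ) := by
  refine (isBigO_const_const (1 : B) one_ne_zero l).add ?_
  simpa using (isBigO_pow_smul (τ := τ) ha c 1).trans (isBigO_pow_one hτ 1)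

lemma isBigO_taylor_two {a : α → B} (hτ : τ =O[l] fun _ => (1 : ℝ))
    (ha : a =O[l] fun _ => (1 : ℝ)) :
    (fun x => 1 + τ x • a x + (τ x ^ 2 / 2) • (a x * a x)) =O[l] fun _ => (1 : ℝ) := by
  have h1 := isBigO_taylor_one hτ ha 1
  have h2 := (isBigO_pow_smul (τ := τ) (by simpa using ha.mul ha) (1 / 2) 2).trans
    (isBigO_pow_one hτ 2)
  refine (h1.add h2).congr_left fun x => ?_
  rw [mul_one, mul_one_div]

/-- Second-order expansion of the product of exponentials of commuting elements. -/
lemma isBigO_commuting_expansion {e f a b : α → B} (hτ : τ =O[l] fun _ => (1 : ℝ))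
    (ha : a =O[l] fun _ => (1 : ℝ)) (hb : b =O[l] fun _ => (1 : ℝ))
    (hab : ∀ x, a x * b x = b x * a x)
    (he : (fun x => e x - (1 + τ x • a x + (τ x ^ 2 / 2) • (a x * a x))) =O[l] fun x => τ x ^ 3)
    (hf : (fun x => f x - (1 + τ x • b x + (τ x ^ 2 / 2) • (b x * b x))) =O[l] fun x => τ x ^ 3) :
    (fun x => e x * f x - (1 + τ x • (a x + b x)
      + (τ x ^ 2 / 2) • ((a x + b x) * (a x + b x)))) =O[l] fun x => τ x ^ 3 := by
  have h1 := isBigO_mul_sub_mul he hf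
    (isBigO_one_of_sub (isBigO_pow_one hτ 3) hf (isBigO_taylor_two hτ hb))
    (isBigO_taylor_two hτ ha)
  -- The product of the two quadratic polynomials exceeds that of `a + b` by exactly `(τ³/2)(aab +
  -- abb) + (τ⁴/4) aabb`.
  have haab : (fun x => a x * (a x * b x)) =O[l] fun _ => (1 : ℝ) := by
    simpa using ha.mul (ha.mul hb)
  have habb : (fun x => a x * (b x * b x)) =O[l] fun _ => (1 : ℝ) := by
    simpa using ha.mul (hb.mul hb)
  have haabb : (fun x => a x * (a x * (b x * b x))) =O[l] fun _ => (1 : ℝ) := by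
    simpa using ha.mul (ha.mul (hb.mul hb))
  have h4 : (fun x => (τ x ^ 3) • (τ x • (a x * (a x * (b x * b x))))) =O[l] fun x => τ x ^ 3 := by
    simpa using (isBigO_refl (fun x => τ x ^ 3) l).smul (hτ.smul haabb)
  refine (h1.add (((isBigO_pow_smul haab (1 / 2) 3).add (isBigO_pow_smul habb (1 / 2) 3)).add
    (h4.const_smul_left (1 / 4 : ℝ)))).congr_left fun x => ?_
  simp only [Pi.smul_apply, add_mul, mul_add, one_mul, mul_one, smul_mul_assoc, mul_smul_comm,
    smul_smul, mul_assoc, ← hab x, smul_add]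
  module

/-- First-order expansion of the product of exponentials. -/
lemma isBigO_mul_expansion {e f a b : α → B} (c : ℝ) (hτ : τ =O[l] fun _ => (1 : ℝ))
    (ha : a =O[l] fun _ => (1 : ℝ)) (hb : b =O[l] fun _ => (1 : ℝ))
    (he : (fun x => e x - (1 + (τ x * c) • a x)) =O[l] fun x => τ x ^ 2)
    (hf : (fun x => f x - (1 + (τ x * c) • b x)) =O[l] fun x => τ x ^ 2) :
    (fun x => e x * f x - (1 + (τ x * c) • (a x + b x))) =O[l] fun x => τ x ^ 2 := by
  have h1 := isBigO_mul_sub_mul he hf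
    (isBigO_one_of_sub (isBigO_pow_one hτ 2) hf (isBigO_taylor_one hτ hb c))
    (isBigO_taylor_one hτ ha c)
  refine (h1.add (isBigO_pow_smul (by simpa using ha.mul hb) (c ^ 2) 2)).congr_left fun x => ?_
  simp only [add_mul, mul_add, one_mul, mul_one, smul_mul_assoc, mul_smul_comm]
  module

/-- Second-order expansion of one step of the exponential midpoint scheme. -/
theorem isBigO_midpoint_expansion {e h h' a b a' b' : α → B} (hτ : τ =O[l] fun _ => (1 : ℝ))
    (ha : a =O[l] fun _ => (1 : ℝ)) (hb : b =O[l] fun _ => (1 : ℝ))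
    (ha' : a' =O[l] fun _ => (1 : ℝ)) (hb' : b' =O[l] fun _ => (1 : ℝ))
    (haa : (fun x => a' x - a x) =O[l] τ) (hbb : (fun x => b' x - b x) =O[l] τ)
    (he : (fun x => e x - (1 + τ x • a x + (τ x ^ 2 / 2) • (a x * a x))) =O[l] fun x => τ x ^ 3)
    (hh : (fun x => h x - (1 + (τ x * (1 / 2)) • a x)) =O[l] fun x => τ x ^ 2)
    (hh' : (fun x => h' x - (1 + (τ x * (1 / 2)) • a' x)) =O[l] fun x => τ x ^ 2) :
    (fun x => e x + τ x • (h x * (b x * (h' x * (1 + (τ x * (1 / 2)) • b' x))))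
      - (1 + τ x • (a x + b x) + (τ x ^ 2 / 2) • ((a x + b x) * (a x + b x))))
      =O[l] fun x => τ x ^ 3 := by
  have hab : (fun x => a x + b x) =O[l] fun _ => (1 : ℝ) := ha.add hb
  have h1 : (fun x => h' x * (1 + (τ x * (1 / 2)) • b' x)
      - (1 + (τ x * (1 / 2)) • (a' x + b' x))) =O[l] fun x => τ x ^ 2 :=
    isBigO_mul_expansion _ hτ ha' hb' hh' ((isBigO_zero _ l).congr_left fun x => by simp)
  -- Moving `a', b'` from the endpoint to the midpoint inside a term of order `τ` costs `O(τ²)`.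
  have h2 : (fun x => h' x * (1 + (τ x * (1 / 2)) • b' x)
      - (1 + (τ x * (1 / 2)) • (a x + b x))) =O[l] fun x => τ x ^ 2 := by
    have h3 : (fun x => τ x • ((1 / 2 : ℝ) • ((a' x - a x) + (b' x - b x))))
        =O[l] fun x => τ x ^ 2 := by
      simpa [sq] using (isBigO_refl τ l).smul ((haa.add hbb).const_smul_left (1 / 2 : ℝ))
    refine (h1.add h3).congr_left fun x => ?_
    module
  have hb2 : (fun x => b x + (τ x * (1 / 2)) • (b x * (a x + b x))) =O[l] fun _ => (1 : ℝ) := by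
    refine hb.add ?_
    simpa using (isBigO_pow_smul (τ := τ) (by simpa using hb.mul hab) (1 / 2) 1).trans
      (isBigO_pow_one hτ 1)
  have h4 : (fun x => b x * (h' x * (1 + (τ x * (1 / 2)) • b' x))
      - (b x + (τ x * (1 / 2)) • (b x * (a x + b x)))) =O[l] fun x => τ x ^ 2 := by
    refine ((hb.mul h2).congr_right fun x => one_mul _).congr_left fun x => ?_
    simp only [mul_sub, mul_add, mul_one, mul_smul_comm]
  -- The jump factor is `b + (τ/2)(ab + ba + b²)` up to `O(τ²)`; times `τ`, it supplies what `e`,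
  -- with its `(τ²/2) a²`, lacks of `(τ²/2)(a + b)²`.
  have h5 := isBigO_mul_sub_mul hh h4 (isBigO_one_of_sub (isBigO_pow_one hτ 2) h4 hb2)
    (isBigO_taylor_one hτ ha (1 / 2))
  have h6 := (h5.add (isBigO_pow_smul (τ := τ)
    (by simpa using ha.mul (hb.mul hab) : (fun x => a x * (b x * (a x + b x))) =O[l] _)
    ((1 / 2) ^ 2) 2))
  have h7 := (isBigO_refl τ l).smul h6
  refine (he.add (h7.congr_right fun x => by rw [smul_eq_mul]; ring)).congr_left fun x => ?_
  simp only [add_mul, mul_add, one_mul, mul_one, smul_mul_assoc, mul_smul_comm, smul_smul,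
    smul_add, smul_sub, mul_assoc]
  module

end Expansion

end Lindblad

namespace Lindblad

/-! ### Expansion of the exact solution -/

section ExactSolution

variable {E : Type*} [NormedAddCommGroup E] [NormedSpace ℝ E] {T : ℝ}

/-- The pairs `(τ, t)` of a step size and a time for which the step from `t` back to `t - τ` stays
inside `[0, T]`. -/
def stepSet (T : ℝ) : Set (ℝ × ℝ) := {x | 0 < x.1 ∧ x.1 ≤ x.2 ∧ x.2 ≤ T}

lemma isBigO_step_one : (fun x : ℝ × ℝ => x.1) =O[𝓟 (stepSet T)] fun _ => (1 : ℝ) :=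
  isBigO_principal.2 ⟨T, fun x hx => by
    rw [Real.norm_of_nonneg hx.1.le, norm_one, mul_one]
    exact hx.2.1.trans hx.2.2⟩

/-- Bootstrap: `q` continuous makes `q'` continuous, so `q` is `C¹`, so `q'` is `C¹`. -/
lemma contDiffOn_of_linear_ode {ℓ : ℝ → E →L[ℝ] E} {q : ℝ → E} (hT : 0 < T)
    (hℓ : ContDiffOn ℝ 2 ℓ (Set.Icc 0 T))
    (hq : ∀ t ∈ Set.Icc 0 T, HasDerivWithinAt q (-(ℓ t (q t))) (Set.Icc 0 T) t) :
    ContDiffOn ℝ 2 q (Set.Icc 0 T) := by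
  have hU := uniqueDiffOn_Icc hT
  have hd : DifferentiableOn ℝ q (Set.Icc 0 T) := fun t ht => (hq t ht).differentiableWithinAt
  have hdw : ∀ t ∈ Set.Icc 0 T, derivWithin q (Set.Icc 0 T) t = -(ℓ t (q t)) :=
    fun t ht => (hq t ht).derivWithin (hU t ht)
  have h1 : ContDiffOn ℝ 1 q (Set.Icc 0 T) := by
    refine (contDiffOn_one_iff_derivWithin hU).2 ⟨hd, ?_⟩
    exact (hℓ.continuousOn.clm_apply hd.continuousOn).neg.congr hdw
  rw [show (2 : WithTop ℕ∞) = 1 + 1 by norm_num, contDiffOn_succ_iff_derivWithin hU]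
  refine ⟨hd, by simp, ?_⟩
  exact ((hℓ.of_le (by norm_num)).clm_apply h1).neg.congr hdw

/-- The exact solution of a linear equation satisfies the midpoint expansion. -/
theorem isBigO_exact_sub_midpoint {ℓ : ℝ → E →L[ℝ] E} {q : ℝ → E} (hT : 0 < T)
    (hℓ : ContDiffOn ℝ 2 ℓ (Set.Icc 0 T))
    (hq : ∀ t ∈ Set.Icc 0 T, HasDerivWithinAt q (-(ℓ t (q t))) (Set.Icc 0 T) t) :
    (fun x : ℝ × ℝ => q (x.2 - x.1)
      - (1 + x.1 • ℓ (x.2 - x.1 / 2) + (x.1 ^ 2 / 2) • (ℓ (x.2 - x.1 / 2) * ℓ (x.2 - x.1 / 2))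
        : E →L[ℝ] E) (q x.2)) =O[𝓟 (stepSet T)] fun x => x.1 ^ 3 := by
  have hU := uniqueDiffOn_Icc hT
  have hq2 := contDiffOn_of_linear_ode hT hℓ hq
  -- `G = q'` is again `C²`, so `q` has a bounded third derivative.
  set G : ℝ → E := fun t => -(ℓ t (q t)) with hG
  have hG2 : ContDiffOn ℝ 2 G (Set.Icc 0 T) := (hℓ.clm_apply hq2).neg
  rw [show (2 : WithTop ℕ∞) = 1 + 1 by norm_num, contDiffOn_succ_iff_derivWithin hU] at hG2
  obtain ⟨hGd, -, hG'⟩ := hG2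
  have hG'' := (contDiffOn_one_iff_derivWithin hU).1 hG'
  set G₂ := derivWithin G (Set.Icc 0 T)
  obtain ⟨C₂, hC₂⟩ := isCompact_Icc.exists_bound_of_continuousOn hG'.continuousOn
  obtain ⟨C₃, hC₃⟩ := isCompact_Icc.exists_bound_of_continuousOn hG''.2
  have h0 : (0 : ℝ) ∈ Set.Icc 0 T := ⟨le_rfl, hT.le⟩
  have hC₂0 : 0 ≤ C₂ := (norm_nonneg _).trans (hC₂ 0 h0)
  have hC₃0 : 0 ≤ C₃ := (norm_nonneg _).trans (hC₃ 0 h0)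
  have hGder : ∀ t ∈ Set.Icc 0 T, HasDerivWithinAt G (G₂ t) (Set.Icc 0 T) t :=
    fun t ht => (hGd t ht).hasDerivWithinAt
  -- Midpoint rule: expanding `q` about the midpoint in both directions, the even terms cancel.
  have hmid : (fun x : ℝ × ℝ => q (x.2 - x.1) - q x.2 + x.1 • G (x.2 - x.1 / 2))
      =O[𝓟 (stepSet T)] fun x => x.1 ^ 3 := by
    refine isBigO_principal.2 ⟨2 * C₃, fun x hx => ?_⟩
    obtain ⟨ht, hs, hr⟩ := grid_mem hx.1 hx.2.1 hx.2.2
    have h1 := norm_sub_taylor_two_le hq hGder (fun t ht => (hG''.1 t ht).hasDerivWithinAt)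
      hC₃0 hs ht hC₃
    have h2 := norm_sub_taylor_two_le hq hGder (fun t ht => (hG''.1 t ht).hasDerivWithinAt)
      hC₃0 hs hr hC₃
    rw [show x.2 - (x.2 - x.1 / 2) = x.1 / 2 by ring] at h1
    rw [show x.2 - x.1 - (x.2 - x.1 / 2) = -(x.1 / 2) by ring, abs_neg] at h2
    have h3 : |x.1 / 2| ^ 3 ≤ x.1 ^ 3 := by
      rw [abs_of_nonneg (by linarith [hx.1])]
      exact pow_le_pow_left₀ (by linarith [hx.1]) (by linarith [hx.1]) 3
    have h4 : q (x.2 - x.1) - q x.2 + x.1 • G (x.2 - x.1 / 2) =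
        (q (x.2 - x.1) - q (x.2 - x.1 / 2) - (-(x.1 / 2)) • G (x.2 - x.1 / 2)
          - ((-(x.1 / 2)) ^ 2 / 2) • G₂ (x.2 - x.1 / 2))
        - (q x.2 - q (x.2 - x.1 / 2) - (x.1 / 2) • G (x.2 - x.1 / 2)
          - ((x.1 / 2) ^ 2 / 2) • G₂ (x.2 - x.1 / 2)) := by module
    rw [h4, Real.norm_of_nonneg (pow_nonneg hx.1.le 3)]
    refine (norm_sub_le _ _).trans ((add_le_add h2 h1).trans ?_)
    linarith [mul_le_mul_of_nonneg_left h3 hC₃0]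
  have hhalf : (fun x : ℝ × ℝ => q (x.2 - x.1 / 2) - q x.2 + (x.1 / 2) • G x.2)
      =O[𝓟 (stepSet T)] fun x => x.1 ^ 2 := by
    refine isBigO_principal.2 ⟨C₂, fun x hx => ?_⟩
    obtain ⟨ht, hs, hr⟩ := grid_mem hx.1 hx.2.1 hx.2.2
    have h1 := norm_sub_taylor_one_le (k := 1) hq hC₂0 ht hs fun y hy =>
      norm_sub_le_pow_succ (k := 0) hGder hC₂0 ht hy fun t ht => by simpa using hC₂ t ht
    rw [show x.2 - x.1 / 2 - x.2 = -(x.1 / 2) by ring, abs_neg, neg_smul, sub_neg_eq_add] at h1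
    refine h1.trans (mul_le_mul_of_nonneg_left ?_ hC₂0)
    rw [abs_of_nonneg (by linarith [hx.1]), Real.norm_of_nonneg (pow_nonneg hx.1.le 2)]
    exact pow_le_pow_left₀ (by linarith [hx.1]) (by linarith [hx.1]) 2
  have hℓs : (fun x : ℝ × ℝ => ℓ (x.2 - x.1 / 2)) =O[𝓟 (stepSet T)] fun _ => (1 : ℝ) :=
    isBigO_principal_one_of_continuousOn hℓ.continuousOn
      fun x hx => (grid_mem hx.1 hx.2.1 hx.2.2).2.1
  have hqt : (fun x : ℝ × ℝ => q x.2) =O[𝓟 (stepSet T)] fun _ => (1 : ℝ) :=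
    isBigO_principal_one_of_continuousOn hq2.continuousOn
      fun x hx => (grid_mem hx.1 hx.2.1 hx.2.2).1
  have hℓd : (fun x : ℝ × ℝ => ℓ x.2 - ℓ (x.2 - x.1 / 2)) =O[𝓟 (stepSet T)] fun x => x.1 := by
    refine (isBigO_principal_sub_of_contDiffOn hT (hℓ.of_le (by norm_num))
      (fun x hx => (grid_mem hx.1 hx.2.1 hx.2.2).1)
      fun x hx => (grid_mem hx.1 hx.2.1 hx.2.2).2.1).trans ?_
    refine ((isBigO_refl (fun x : ℝ × ℝ => x.1) _).const_mul_left (1 / 2)).congr_left fun x => ?_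
    ring
  -- With `s = t - τ/2`, the total error is the midpoint-rule error plus `τ ℓ(s)(q(s) - q(t) - (τ/2)
  -- ℓ(t) q(t))` plus `(τ²/2) ℓ(s)(ℓ(t) - ℓ(s)) q(t)`.
  have e1 := (isBigO_refl (fun x : ℝ × ℝ => x.1) (𝓟 (stepSet T))).smul
    (isBigO_clm_apply hℓs hhalf)
  have e2 := (isBigO_refl (fun x : ℝ × ℝ => x.1 ^ 2) (𝓟 (stepSet T))).smul
    ((isBigO_clm_apply hℓs (isBigO_clm_apply hℓd hqt)).const_smul_left (1 / 2 : ℝ))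
  refine (hmid.add ((e1.congr_right (g₂ := fun x => x.1 ^ 3) fun x => by
    rw [smul_eq_mul]; ring).add (e2.congr_right (g₂ := fun x => x.1 ^ 3) fun x => by
    rw [smul_eq_mul]; ring))).congr_left fun x => ?_
  simp only [hG, Pi.smul_apply, add_apply, sub_apply,
    smul_apply, one_apply_eq_self, mul_apply_eq_comp,
    map_add, map_sub, map_smul, map_neg, smul_neg]
  module

end ExactSolution

/-! ### Consistency of the scheme via superoperators -/

section Consistency

variable {m K : ℕ} {T : ℝ} {H : ℝ → Matrix (Fin m) (Fin m) ℂ}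
  {L : Fin K → Matrix (Fin m) (Fin m) ℂ} {γ : Fin K → ℝ → ℝ}

/-- Contractivity bounds the third derivative `e^{tA} A³` by `‖A‖³`, with no exponential factor. -/
lemma norm_exp_sub_taylor_two_le {A : Matrix (Fin m) (Fin m) ℂ} {τ : ℝ} (hτ : 0 ≤ τ)
    (hA : ∀ σ : ℝ, 0 ≤ σ → ‖NormedSpace.exp (σ • A)‖ ≤ 1) :
    ‖NormedSpace.exp (τ • A) - (1 + τ • A + (τ ^ 2 / 2) • (A * A))‖ ≤ ‖A‖ ^ 3 * τ ^ 3 := by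
  have hd := fun t : ℝ => hasDerivAt_exp_smul_const A t
  have h := norm_sub_taylor_two_le (T := τ) (C := ‖A‖ ^ 3) (a := 0) (x := τ)
    (f := fun t => NormedSpace.exp (t • A)) (f₁ := fun t => NormedSpace.exp (t • A) * A)
    (f₂ := fun t => NormedSpace.exp (t • A) * A * A)
    (f₃ := fun t => NormedSpace.exp (t • A) * A * A * A)
    (fun t _ => (hd t).hasDerivWithinAt) (fun t _ => ((hd t).mul_const A).hasDerivWithinAt)
    (fun t _ => (((hd t).mul_const A).mul_const A).hasDerivWithinAt) (by positivity)
    ⟨le_rfl, hτ⟩ ⟨hτ, le_rfl⟩ fun t ht => by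
      rw [mul_assoc, mul_assoc]
      refine (norm_mul_le _ _).trans ((mul_le_of_le_one_left (norm_nonneg _) (hA t ht.1)).trans ?_)
      calc ‖A * (A * A)‖ ≤ ‖A‖ * (‖A‖ * ‖A‖) :=
            (norm_mul_le _ _).trans (mul_le_mul_of_nonneg_left (norm_mul_le _ _) (norm_nonneg _))
        _ = ‖A‖ ^ 3 := by ring
  simp only [sub_zero, zero_smul, NormedSpace.exp_zero, one_mul, abs_of_nonneg hτ] at h
  rwa [sub_sub, sub_sub, ← add_assoc] at h

lemma norm_exp_sub_taylor_one_le {A : Matrix (Fin m) (Fin m) ℂ} {τ : ℝ} (hτ : 0 ≤ τ)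
    (hA : ∀ σ : ℝ, 0 ≤ σ → ‖NormedSpace.exp (σ • A)‖ ≤ 1) :
    ‖NormedSpace.exp (τ • A) - (1 + τ • A)‖ ≤ ‖A‖ ^ 2 * τ ^ 2 := by
  have hd := fun t : ℝ => hasDerivAt_exp_smul_const A t
  have h := norm_sub_taylor_one_le (T := τ) (C := ‖A‖ ^ 2) (a := 0) (x := τ) (k := 1)
    (f := fun t => NormedSpace.exp (t • A)) (f₁ := fun t => NormedSpace.exp (t • A) * A)
    (fun t _ => (hd t).hasDerivWithinAt) (by positivity)
    ⟨le_rfl, hτ⟩ ⟨hτ, le_rfl⟩ fun t ht => by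
      refine norm_sub_le_pow_succ (k := 0) (T := τ)
        (fun t _ => ((hd t).mul_const A).hasDerivWithinAt) (by positivity) ⟨le_rfl, hτ⟩ ht
        fun y hy => ?_
      rw [mul_assoc, pow_zero, mul_one]
      refine (norm_mul_le _ _).trans ((mul_le_of_le_one_left (norm_nonneg _) (hA y hy.1)).trans ?_)
      exact (norm_mul_le _ _).trans_eq (sq _).symm
  simp only [sub_zero, zero_smul, NormedSpace.exp_zero, one_mul, abs_of_nonneg hτ] at h
  rwa [sub_sub] at h

/-- Left multiplication by a matrix, as a superoperator. -/
noncomputable abbrev leftMul : Matrix (Fin m) (Fin m) ℂ →L[ℝ]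
    Matrix (Fin m) (Fin m) ℂ →L[ℝ] Matrix (Fin m) (Fin m) ℂ :=
  ContinuousLinearMap.mul ℝ (Matrix (Fin m) (Fin m) ℂ)

/-- Right multiplication by a matrix, as a superoperator. -/
noncomputable abbrev rightMul : Matrix (Fin m) (Fin m) ℂ →L[ℝ]
    Matrix (Fin m) (Fin m) ℂ →L[ℝ] Matrix (Fin m) (Fin m) ℂ :=
  (ContinuousLinearMap.mul ℝ (Matrix (Fin m) (Fin m) ℂ)).flip

/-- The superoperator `p ↦ A(t)ᴴ p + p A(t)`. -/
noncomputable def driftOp (H : ℝ → Matrix (Fin m) (Fin m) ℂ) (L : Fin K → Matrix (Fin m) (Fin m) ℂ)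
    (γ : Fin K → ℝ → ℝ) (t : ℝ) : Matrix (Fin m) (Fin m) ℂ →L[ℝ] Matrix (Fin m) (Fin m) ℂ :=
  leftMul (opA H L γ t)ᴴ + rightMul (opA H L γ t)

/-- The superoperator `p ↦ ∑ₖ γₖ(t) Lₖᴴ p Lₖ`. -/
noncomputable def jumpOp (L : Fin K → Matrix (Fin m) (Fin m) ℂ)
    (γ : Fin K → ℝ → ℝ) (t : ℝ) : Matrix (Fin m) (Fin m) ℂ →L[ℝ] Matrix (Fin m) (Fin m) ℂ :=
  ∑ k, γ k t • (leftMul (L k)ᴴ * rightMul (L k))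

lemma jumpOp_apply (t : ℝ) (p : Matrix (Fin m) (Fin m) ℂ) :
    jumpOp L γ t p = ∑ k, γ k t • ((L k)ᴴ * p * L k) := by
  simp [jumpOp, mul_assoc]

/-- As `H` is Hermitian, `Aᴴ` contains `+iH`, and commutator and anticommutator merge into `Aᴴ p + p
A`. -/
lemma adjointRHS_eq {t : ℝ} (hH : (H t).IsHermitian) (p : Matrix (Fin m) (Fin m) ℂ) :
    adjointRHS H L γ t p = -((driftOp H L γ t + jumpOp L γ t) p) := by
  simp only [add_apply, jumpOp_apply, driftOp, adjointRHS, opA,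
    Matrix.conjTranspose_sub, Matrix.conjTranspose_neg, Matrix.conjTranspose_smul,
    hH.eq, Matrix.conjTranspose_sum, star_trivial, Matrix.conjTranspose_mul,
    Matrix.conjTranspose_conjTranspose, Complex.star_def, Complex.conj_I,
    ContinuousLinearMap.mul_apply', ContinuousLinearMap.flip_apply, sub_mul, mul_sub,
    neg_mul, mul_neg, smul_mul_assoc, mul_smul_comm, Finset.sum_mul, Finset.mul_sum, smul_sub,
    smul_add, Finset.sum_sub_distrib, Finset.sum_add_distrib, Finset.smul_sum, neg_smul]
  simp only [smul_comm (γ _ _) (1 / 2 : ℝ)]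
  abel

lemma contDiffOn_matrix {n : WithTop ℕ∞} {s : Set ℝ} {F : ℝ → Matrix (Fin m) (Fin m) ℂ}
    (h : ∀ i j, ContDiffOn ℝ n (fun t => F t i j) s) : ContDiffOn ℝ n F s := by
  have h1 : F = fun t => ∑ i, ∑ j, F t i j • Matrix.single i j (1 : ℂ) := by
    funext t
    conv_lhs => rw [Matrix.matrix_eq_sum_single (F t)]
    simp [Matrix.smul_single]
  rw [h1]
  exact ContDiffOn.sum fun i _ => ContDiffOn.sum fun j _ => (h i j).smul contDiffOn_const

lemma contDiffOn_opA {s : Set ℝ} (hH : ∀ i j, ContDiffOn ℝ 2 (fun t => H t i j) s)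
    (hγ : ∀ k, ContDiffOn ℝ 2 (γ k) s) : ContDiffOn ℝ 2 (opA H L γ) s := by
  have h1 : ContDiffOn ℝ 2 (fun t => Complex.I • H t) s := (contDiffOn_matrix hH).const_smul _
  have h2 : ContDiffOn ℝ 2 (fun t => (1 / 2 : ℝ) • ∑ k, γ k t • ((L k)ᴴ * L k)) s :=
    (ContDiffOn.sum fun k _ => (hγ k).smul contDiffOn_const).const_smul _
  exact h1.neg.sub h2

lemma contDiffOn_driftOp {s : Set ℝ} (hH : ∀ i j, ContDiffOn ℝ 2 (fun t => H t i j) s)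
    (hγ : ∀ k, ContDiffOn ℝ 2 (γ k) s) : ContDiffOn ℝ 2 (driftOp H L γ) s := by
  have h := contDiffOn_opA (L := L) hH hγ
  have h' : ContDiffOn ℝ 2 (fun t => (opA H L γ t)ᴴ) s :=
    (starL' ℝ : Matrix (Fin m) (Fin m) ℂ ≃L[ℝ] Matrix (Fin m) (Fin m) ℂ).contDiff.comp_contDiffOn h
  have hl : ContDiffOn ℝ 2 (fun t => leftMul (opA H L γ t)ᴴ) s := contDiffOn_const.clm_apply h'
  have hr : ContDiffOn ℝ 2 (fun t => rightMul (opA H L γ t)) s := contDiffOn_const.clm_apply h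
  exact hl.add hr

lemma contDiffOn_jumpOp {s : Set ℝ} (hγ : ∀ k, ContDiffOn ℝ 2 (γ k) s) :
    ContDiffOn ℝ 2 (jumpOp L γ) s :=
  ContDiffOn.sum fun k _ => (hγ k).smul contDiffOn_const

/-- The superoperator `p ↦ e^{σ A(t)ᴴ} p e^{σ A(t)}`. -/
noncomputable def expOp (H : ℝ → Matrix (Fin m) (Fin m) ℂ) (L : Fin K → Matrix (Fin m) (Fin m) ℂ)
    (γ : Fin K → ℝ → ℝ) (σ t : ℝ) : Matrix (Fin m) (Fin m) ℂ →L[ℝ] Matrix (Fin m) (Fin m) ℂ :=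
  leftMul (NormedSpace.exp (σ • (opA H L γ t)ᴴ)) * rightMul (NormedSpace.exp (σ • opA H L γ t))

lemma expOp_apply (σ t : ℝ) (p : Matrix (Fin m) (Fin m) ℂ) :
    expOp H L γ σ t p =
      NormedSpace.exp (σ • (opA H L γ t)ᴴ) * p * NormedSpace.exp (σ • opA H L γ t) := by
  simp [expOp, mul_assoc]

/-- Puts the step in the product form expected by `isBigO_midpoint_expansion`. -/
lemma backwardStep_eq_apply (τ t : ℝ) (p : Matrix (Fin m) (Fin m) ℂ) :
    backwardStep H L γ τ t p = (expOp H L γ τ (t - τ / 2)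
      + τ • (expOp H L γ (τ / 2) (t - τ / 2) * (jumpOp L γ (t - τ / 2)
        * (expOp H L γ (τ / 2) t * (1 + (τ * (1 / 2)) • jumpOp L γ t))))) p := by
  simp only [add_apply, smul_apply,
    mul_apply_eq_comp, one_apply_eq_self, expOp_apply, jumpOp_apply,
    backwardStep, halfStep, Finset.mul_sum, Finset.sum_mul, mul_smul_comm, smul_mul_assoc,
    mul_one_div]

variable (T H L γ) in
/-- The dissipativity of `A(t)` on `[0, T]`, in the form of contractivity of its semigroups. -/
def IsContractive : Prop :=
  ∀ t ∈ Set.Icc (0 : ℝ) T, ∀ σ : ℝ, 0 ≤ σ → ‖NormedSpace.exp (σ • opA H L γ t)‖ ≤ 1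

lemma leftMul_mul (X Y : Matrix (Fin m) (Fin m) ℂ) : leftMul (X * Y) = leftMul X * leftMul Y := by
  ext1 p; simp [mul_assoc]

lemma rightMul_mul (X Y : Matrix (Fin m) (Fin m) ℂ) :
    rightMul (X * Y) = rightMul Y * rightMul X := by
  ext1 p; simp [mul_assoc]

lemma leftMul_one : leftMul (1 : Matrix (Fin m) (Fin m) ℂ) = 1 := by ext1 p; simp

lemma rightMul_one : rightMul (1 : Matrix (Fin m) (Fin m) ℂ) = 1 := by ext1 p; simp

/-- Left and right multiplications commute, so the commuting expansion applies to the two factors of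
the conjugation. -/
lemma isBigO_expOp_two (hA : ContinuousOn (opA H L γ) (Set.Icc 0 T))
    (hc : IsContractive T H L γ) {u : ℝ × ℝ → ℝ} (hu : ∀ x ∈ stepSet T, u x ∈ Set.Icc 0 T) :
    (fun x => expOp H L γ x.1 (u x) - (1 + x.1 • driftOp H L γ (u x)
      + (x.1 ^ 2 / 2) • (driftOp H L γ (u x) * driftOp H L γ (u x))))
      =O[𝓟 (stepSet T)] fun x => x.1 ^ 3 := by
  obtain ⟨C, hC⟩ := isCompact_Icc.exists_bound_of_continuousOn hA
  have hA1 : (fun x => opA H L γ (u x)) =O[𝓟 (stepSet T)] fun _ => (1 : ℝ) :=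
    isBigO_principal_one_of_continuousOn hA hu
  have hA2 : (fun x => (opA H L γ (u x))ᴴ) =O[𝓟 (stepSet T)] fun _ => (1 : ℝ) :=
    (isBigO_of_le _ fun x => (Matrix.l2_opNorm_conjTranspose _).le).trans hA1
  have hR : (fun x => NormedSpace.exp (x.1 • opA H L γ (u x)) - (1 + x.1 • opA H L γ (u x)
      + (x.1 ^ 2 / 2) • (opA H L γ (u x) * opA H L γ (u x))))
      =O[𝓟 (stepSet T)] fun x => x.1 ^ 3 := by
    refine isBigO_principal.2 ⟨C ^ 3, fun x hx => ?_⟩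
    rw [Real.norm_of_nonneg (pow_nonneg hx.1.le 3)]
    exact (norm_exp_sub_taylor_two_le hx.1.le (hc _ (hu x hx))).trans (mul_le_mul_of_nonneg_right
      (pow_le_pow_left₀ (norm_nonneg _) (hC _ (hu x hx)) 3) (pow_nonneg hx.1.le 3))
  have hL : (fun x => NormedSpace.exp (x.1 • (opA H L γ (u x))ᴴ) - (1 + x.1 • (opA H L γ (u x))ᴴ
      + (x.1 ^ 2 / 2) • ((opA H L γ (u x))ᴴ * (opA H L γ (u x))ᴴ)))
      =O[𝓟 (stepSet T)] fun x => x.1 ^ 3 := by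
    refine (isBigO_of_le _ fun x => ?_).trans hR
    rw [← Matrix.l2_opNorm_conjTranspose]
    simp [← Matrix.exp_conjTranspose, Matrix.conjTranspose_smul]
  refine isBigO_commuting_expansion
    (B := Matrix (Fin m) (Fin m) ℂ →L[ℝ] Matrix (Fin m) (Fin m) ℂ) isBigO_step_one
    ((leftMul.isBigO_comp _ _).trans hA2) ((rightMul.isBigO_comp _ _).trans hA1)
    (fun x => by ext1 p; simp [mul_assoc])
    (((leftMul.isBigO_comp _ _).trans hL).congr_left fun x => ?_)
    (((rightMul.isBigO_comp _ _).trans hR).congr_left fun x => ?_)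
  · simp only [map_sub, map_add, map_smul, leftMul_mul, leftMul_one]
  · simp only [map_sub, map_add, map_smul, rightMul_mul, rightMul_one]

lemma isBigO_expOp_one (hA : ContinuousOn (opA H L γ) (Set.Icc 0 T))
    (hc : IsContractive T H L γ) {u : ℝ × ℝ → ℝ} (hu : ∀ x ∈ stepSet T, u x ∈ Set.Icc 0 T) :
    (fun x => expOp H L γ (x.1 / 2) (u x) - (1 + (x.1 * (1 / 2)) • driftOp H L γ (u x)))
      =O[𝓟 (stepSet T)] fun x => x.1 ^ 2 := by
  obtain ⟨C, hC⟩ := isCompact_Icc.exists_bound_of_continuousOn hA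
  have hA1 : (fun x => opA H L γ (u x)) =O[𝓟 (stepSet T)] fun _ => (1 : ℝ) :=
    isBigO_principal_one_of_continuousOn hA hu
  have hA2 : (fun x => (opA H L γ (u x))ᴴ) =O[𝓟 (stepSet T)] fun _ => (1 : ℝ) :=
    (isBigO_of_le _ fun x => (Matrix.l2_opNorm_conjTranspose _).le).trans hA1
  have hR : (fun x => NormedSpace.exp ((x.1 / 2) • opA H L γ (u x))
      - (1 + (x.1 * (1 / 2)) • opA H L γ (u x))) =O[𝓟 (stepSet T)] fun x => x.1 ^ 2 := by
    refine isBigO_principal.2 ⟨C ^ 2, fun x hx => ?_⟩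
    have hx0 : 0 ≤ x.1 / 2 := by linarith [hx.1]
    rw [Real.norm_of_nonneg (pow_nonneg hx.1.le 2), mul_one_div]
    refine (norm_exp_sub_taylor_one_le hx0 (hc _ (hu x hx))).trans (mul_le_mul
      (pow_le_pow_left₀ (norm_nonneg _) (hC _ (hu x hx)) 2)
      (pow_le_pow_left₀ hx0 (by linarith [hx.1]) 2) (by positivity) (by positivity))
  have hL : (fun x => NormedSpace.exp ((x.1 / 2) • (opA H L γ (u x))ᴴ)
      - (1 + (x.1 * (1 / 2)) • (opA H L γ (u x))ᴴ)) =O[𝓟 (stepSet T)] fun x => x.1 ^ 2 := by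
    refine (isBigO_of_le _ fun x => ?_).trans hR
    rw [← Matrix.l2_opNorm_conjTranspose]
    simp [← Matrix.exp_conjTranspose, Matrix.conjTranspose_smul]
  refine isBigO_mul_expansion
    (B := Matrix (Fin m) (Fin m) ℂ →L[ℝ] Matrix (Fin m) (Fin m) ℂ) _ isBigO_step_one
    ((leftMul.isBigO_comp _ _).trans hA2) ((rightMul.isBigO_comp _ _).trans hA1)
    (((leftMul.isBigO_comp _ _).trans hL).congr_left fun x => ?_)
    (((rightMul.isBigO_comp _ _).trans hR).congr_left fun x => ?_)
  · simp only [map_sub, map_add, map_smul, leftMul_one]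
  · simp only [map_sub, map_add, map_smul, rightMul_one]

/-- Third-order local accuracy of the scheme along the exact solution. -/
theorem isBigO_exact_sub_backwardStep {q : ℝ → Matrix (Fin m) (Fin m) ℂ} (hT : 0 < T)
    (hH : ∀ t ∈ Set.Icc (0 : ℝ) T, (H t).IsHermitian)
    (hHsmooth : ∀ i j, ContDiffOn ℝ 2 (fun t => H t i j) (Set.Icc (0 : ℝ) T))
    (hγ : ∀ k, ∀ t ∈ Set.Icc (0 : ℝ) T, 0 ≤ γ k t)
    (hγsmooth : ∀ k, ContDiffOn ℝ 2 (γ k) (Set.Icc (0 : ℝ) T))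
    (hq : ∀ t ∈ Set.Icc (0 : ℝ) T,
      HasDerivWithinAt q (adjointRHS H L γ t (q t)) (Set.Icc (0 : ℝ) T) t) :
    (fun x : ℝ × ℝ => q (x.2 - x.1) - backwardStep H L γ x.1 x.2 (q x.2))
      =O[𝓟 (stepSet T)] fun x => x.1 ^ 3 := by
  have hc : IsContractive T H L γ := fun t ht σ hσ =>
    norm_exp_smul_le_one (posSemidef_neg_opA_add_conjTranspose (hH t ht) fun k => hγ k t ht) hσ
  have hA := (contDiffOn_opA (L := L) hHsmooth hγsmooth).continuousOn
  have ha := contDiffOn_driftOp (L := L) hHsmooth hγsmooth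
  have hb := contDiffOn_jumpOp (L := L) hγsmooth
  have hmt : ∀ x ∈ stepSet T, x.2 ∈ Set.Icc 0 T :=
    fun x hx => (grid_mem hx.1 hx.2.1 hx.2.2).1
  have hms : ∀ x ∈ stepSet T, x.2 - x.1 / 2 ∈ Set.Icc 0 T :=
    fun x hx => (grid_mem hx.1 hx.2.1 hx.2.2).2.1
  have hdiff : (fun x : ℝ × ℝ => x.2 - (x.2 - x.1 / 2)) =O[𝓟 (stepSet T)] fun x => x.1 :=
    ((isBigO_refl (fun x : ℝ × ℝ => x.1) _).const_mul_left (1 / 2)).congr_left fun x => by ring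
  have hexact := isBigO_exact_sub_midpoint hT (ha.add hb) fun t ht => by
    have h := hq t ht
    rw [adjointRHS_eq (hH t ht)] at h
    exact h
  have hΦ := isBigO_midpoint_expansion
    (B := Matrix (Fin m) (Fin m) ℂ →L[ℝ] Matrix (Fin m) (Fin m) ℂ) isBigO_step_one
    (isBigO_principal_one_of_continuousOn ha.continuousOn hms)
    (isBigO_principal_one_of_continuousOn hb.continuousOn hms)
    (isBigO_principal_one_of_continuousOn ha.continuousOn hmt)
    (isBigO_principal_one_of_continuousOn hb.continuousOn hmt)
    ((isBigO_principal_sub_of_contDiffOn hT (ha.of_le (by norm_num)) hmt hms).trans hdiff)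
    ((isBigO_principal_sub_of_contDiffOn hT (hb.of_le (by norm_num)) hmt hms).trans hdiff)
    (isBigO_expOp_two hA hc hms) (isBigO_expOp_one hA hc hms) (isBigO_expOp_one hA hc hmt)
  have hqt : (fun x : ℝ × ℝ => q x.2) =O[𝓟 (stepSet T)] fun _ => (1 : ℝ) :=
    isBigO_principal_one_of_continuousOn (fun t ht => (hq t ht).continuousWithinAt) hmt
  refine (hexact.sub ((isBigO_clm_apply hΦ hqt).congr_right fun x => mul_one _)).congr_left
    fun x => ?_
  rw [backwardStep_eq_apply, sub_apply]
  exact sub_sub_sub_cancel_right _ _ _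

theorem exists_isConsistencyConst {q : ℝ → Matrix (Fin m) (Fin m) ℂ} (hT : 0 < T)
    (h : (fun x : ℝ × ℝ => q (x.2 - x.1) - backwardStep H L γ x.1 x.2 (q x.2))
      =O[𝓟 (stepSet T)] fun x => x.1 ^ 3) : ∃ C₁ : ℝ, IsConsistencyConst T H L γ q C₁ := by
  obtain ⟨c, hc, h⟩ := h.exists_pos
  rw [isBigOWith_principal] at h
  -- `m` converts operator norm to trace norm; `+ 1` keeps the constant positive when `m = 0`.
  refine ⟨m * c + 1, by positivity, fun N hN n hn => ?_⟩
  obtain ⟨hτ, h1, h2⟩ := step_le_grid hT hn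
  have h3 := h (T / N, ((n + 1 : ℕ) : ℝ) * (T / N)) ⟨hτ, h1, h2⟩
  simp only [Real.norm_of_nonneg (pow_nonneg hτ.le 3)] at h3
  rw [show ((n + 1 : ℕ) : ℝ) * (T / N) - T / N = n * (T / N) by push_cast; ring] at h3
  have h4 : 0 ≤ (T / N) ^ 3 := pow_nonneg hτ.le 3
  calc traceNorm (truncError T H L γ q N n) ≤ m * ‖truncError T H L γ q N n‖ :=
        traceNorm_le_mul_norm _
    _ ≤ m * (c * (T / N) ^ 3) := mul_le_mul_of_nonneg_left h3 (Nat.cast_nonneg m)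
    _ ≤ (m * c + 1) * (T / N) ^ 3 := by linarith

end Consistency

end Lindblad

theorem theorem4p1 {m K : ℕ} (T : ℝ) (hT : 0 < T)
    (H : ℝ → Matrix (Fin m) (Fin m) ℂ)
    (L : Fin K → Matrix (Fin m) (Fin m) ℂ)
    (γ : Fin K → ℝ → ℝ)
    (Q : Matrix (Fin m) (Fin m) ℂ)
    (q : ℝ → Matrix (Fin m) (Fin m) ℂ)
    (hH : ∀ t ∈ Set.Icc (0 : ℝ) T, (H t).IsHermitian)
    (hHsmooth : ∀ i j, ContDiffOn ℝ 2 (fun t => H t i j) (Set.Icc (0 : ℝ) T))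
    (hγ : ∀ k, ∀ t ∈ Set.Icc (0 : ℝ) T, 0 ≤ γ k t)
    (hγsmooth : ∀ k, ContDiffOn ℝ 2 (γ k) (Set.Icc (0 : ℝ) T))
    (hQ : Q.PosSemidef) (hQtr : Q.trace = 1)
    (hq : Lindblad.IsAdjointSolution T H L γ Q q) :
    (∃ C₁ : ℝ, Lindblad.IsConsistencyConst T H L γ q C₁) ∧
    ∀ C₁ : ℝ, Lindblad.IsConsistencyConst T H L γ q C₁ →
      0 < Lindblad.constC₃ T C₁ (Lindblad.constC₂ T L γ) ∧
      ∀ N : ℕ, 1 ≤ N → ∀ x : ℕ → Matrix (Fin m) (Fin m) ℂ,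
        Lindblad.IsBackwardFREM T H L γ Q N x →
        ∀ n ≤ N,
          Lindblad.traceNorm (q ((n : ℝ) * (T / N)) - x n)
            ≤ Lindblad.constC₃ T C₁ (Lindblad.constC₂ T L γ) * (T / N) ^ 2 := by
  refine ⟨Lindblad.exists_isConsistencyConst hT (Lindblad.isBigO_exact_sub_backwardStep hT hH
    hHsmooth hγ hγsmooth hq.1), fun C₁ hC₁ => ⟨Lindblad.constC₃_pos hT
    (Lindblad.constC₂_nonneg hγ) hC₁.1, fun N hN x hx n hn => ?_⟩⟩
  -- Compactness bounds the images of `γₖ`, so `sSup` in `constC₂` really dominates them; on an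
  -- unbounded set it would default to `0`.
  exact Lindblad.traceNorm_error_le hT hH hγ
    (fun k => (isCompact_Icc.image_of_continuousOn (hγsmooth k).continuousOn).bddAbove)
    hq.2 hC₁ hN hx hn
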